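/- **Setting.** Let $N\ge 1$, $m, n_i, m_i\ge 0$, $t_0\in\mathbb R$, $\mathcal N=\{1,\dots,N\}$, $\mathcal M=\{1,\dots,m\}$; $\|\cdot\|_\infty$ is the maximum norm (and the induced matrix norm), and $\|x\|_A:=\inf_{a\in A}\|x-a\|_\infty$. Consider the agents $$\dot y_i=F_i(t,y_i,z_i)+\Gamma_i(t,w_i)u_i,\quad \dot z_i=Z_i(t,z_i,y_i),\quad w_i=W_i(y_i,z_i),\qquad i\in\mathcal N,$$ with $y_i,u_i\in\mathbb R^m$, $z_i\in\mathbb R^{n_i}$, $w_i\in\mathbb R^{m_i}$, and the edge-wise funnel coupling $$u_i=\Gamma_i(t,w_i)^{-1}\sum_{j\in\mathcal N_i}\mathrm{col}\Big(\mu_{ij}^1\big(\tfrac{\nu_{ij}^1}{\psi_{ij}^1(t)}\big),\dots,\mu_{ij}^m\big(\tfrac{\nu_{ij}^m}{\psi_{ij}^m(t)}\big)\Big),\qquad \nu_{ij}=y_j-y_i,$$ where $\mathcal N_i$ is the set of neighbours of $i$ in a graph $\mathcal G=(\mathcal N,\mathcal E)$. The coupling is defined only where $|\nu_{ij}^p|<\psi_{ij}^p(t)$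 for all edges and all $p\in\mathcal M$ (inside the funnel). Solutions are Carathéodory solutions, and solutions of the closed loop are maximal solutions inside the funnel. In particular their initial values lie inside the funnel. **Assumptions.** 1. $F_i,Z_i,\Gamma_i$ (defined for $t\ge t_0$) are measurable in $t$, locally Lipschitz in the remaining variables (locally uniformly in $t$), and bounded on compact sets of these variables uniformly in $t\ge t_0$; $W_i$ is locally Lipschitz. 2. $\Gamma_i(t,w)$ is always invertible, and $\|\Gamma_i(t,w)^{-1}\|_\infty\le M_\Gamma$ for some constant $M_\Gamma>0$. 3. $\mathcal G$ is undirected (without self-loops) and connected. 4. For all edges and $p\in\mathcal M$: $\psi_{ij}^p=\psi_{ji}^p:[t_0,\infty)\to(0,\infty)$ is bounded and $C^1$ with bounded derivative; $\mu_{ij}^p:(-1,1)\to\mathbb R$ is continuous, $\mu_{ij}^p(s)\to\pm\infty$ as $s\to\pm1$, and $\mu_{ij}^p(-s)=-\mu_{ji}^p(s)$. 5. Let $d_{\mathcal G}$ be the diameter of $\mathcal G$ and $\Psi(t):=\max_{p\in\mathcal M}\max_{(j,i)\in\mathcal E}\psi_{ij}^p(t)$ (with $\Psi:=0$ if there is no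 edge or $m=0$). For every initial time $t_1\ge t_0$, every initial value, and all locally absolutely continuous $e_i:[t_1,\infty)\to\mathbb R^m$ with $\|e_i(t)\|_\infty\le d_{\mathcal G}\Psi(t)$, the perturbed blended dynamics $$\dot s=\frac1N\sum_{i=1}^N F_i(t,s+e_i,z_i),\qquad \dot z_i=Z_i(t,z_i,s+e_i),\quad i\in\mathcal N,$$ has a global solution. **ISS.** Let $A$ be a nonempty closed set, $\beta\in\mathcal{KL}$ and $\hat\gamma\in\mathcal K_\infty$. Assume that the perturbed blended dynamics, with state $x=\mathrm{col}(s,z_1,\dots,z_N)$ and input $e=\mathrm{col}(e_1,\dots,e_N)$, is ISS with $(\beta,\hat\gamma)$ for $A$: for every initial time $t_1\ge t_0$, every initial value and every measurable, locally essentially bounded input $e$ on $[t_1,\infty)$, a global solution exists, and it satisfies $$\|x(t)\|_A\le\beta(\|x(t_1)\|_A,t-t_1)+\hat\gamma\big(\operatorname{ess\,sup}_{s\in[t_1,t)}\|e(s)\|_\infty\big)\qquad\text{for all }t\ge t_1.$$ **Theorem.** Under these assumptions, for every $M_{x_0}>0$ and every non-increasing $w:[0,\infty)\to(0,1]$ with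 $\lim_{t\to\infty}w(t)=0$ there exists $\gamma\in\mathcal K_\infty$ such that the following holds for every initial time $t_1\ge t_0$. Every maximal solution $\mathrm{col}(y_1,z_1,\dots,y_N,z_N)$ of the closed loop starting at time $t_1$ inside the funnel with $\big\|\mathrm{col}\big(\tfrac1N\sum_{i}y_i(t_1),z_1(t_1),\dots,z_N(t_1)\big)\big\|_A\le M_{x_0}$ exists on $[t_1,\infty)$, and for all $t\ge t_1$ $$\max_{i\in\mathcal N}\left\|\begin{bmatrix}y_i(t)\\z_1(t)\\\vdots\\z_N(t)\end{bmatrix}\right\|_A\le\beta\left(\left\|\begin{bmatrix}\frac1N\sum_{i=1}^N y_i(t_1)\\z_1(t_1)\\\vdots\\z_N(t_1)\end{bmatrix}\right\|_A,\,t-t_1\right)+\gamma\Big(\sup_{s\in[t_1,t)}d_{\mathcal G}\Psi(s)\,w(t-s)\Big)+d_{\mathcal G}\Psi(t),$$ where the supremum over the empty set is $0$. -/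

import Mathlib

open MeasureTheory Filter Topology
open scoped Matrix ENNReal

namespace FunnelCoupling

/-! ### Comparison functions -/

/-- Class `K` functions on `[0, ∞)` (values at negative arguments are irrelevant). -/
structure IsClassK (α : ℝ → ℝ) : Prop where
  continuousOn : ContinuousOn α (Set.Ici 0)
  strictMonoOn : StrictMonoOn α (Set.Ici 0)
  map_zero : α 0 = 0

/-- Class `K∞` functions on `[0, ∞)`. -/
structure IsClassKInfty (α : ℝ → ℝ) : Prop extends IsClassK α where
  tendsto_atTop : Tendsto α atTop atTop

/-- Class `KL` functions on `[0, ∞) × [0, ∞)`. -/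
structure IsClassKL (β : ℝ → ℝ → ℝ) : Prop where
  isClassK : ∀ t, 0 ≤ t → IsClassK (fun r => β r t)
  antitoneOn : ∀ r, 0 ≤ r → AntitoneOn (β r) (Set.Ici 0)
  tendsto_zero : ∀ r, 0 ≤ r → Tendsto (β r) atTop (𝓝 0)

/-! ### Carathéodory solutions -/

/-- The time interval `[t₁, ω)` with `ω ≤ ∞`. -/
def timeInterval (t₁ : ℝ) (ω : EReal) : Set ℝ := {t | t₁ ≤ t ∧ (t : EReal) < ω}

section Systems

variable {X U : Type*} [NormedAddCommGroup X] [NormedSpace ℝ X] [NormedAddCommGroup U]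

/-- `x` is a Carathéodory solution on `[t₁, ω)` of `x' = f (t, x)`, where the right-hand side is
only considered on the domain `Ω`: `x` is the integral of the locally integrable function
`s ↦ f (s, x s)`, i.e. `x` is locally absolutely continuous and solves the equation almost
everywhere, and its graph lies in `Ω`. -/
structure IsSolution (Ω : Set (ℝ × X)) (f : ℝ → X → X) (t₁ : ℝ) (ω : EReal) (x : ℝ → X) :
    Prop where
  lt : (t₁ : EReal) < ω
  mem_domain : ∀ t ∈ timeInterval t₁ ω, (t, x t) ∈ Ω
  integrable : ∀ t ∈ timeInterval t₁ ω, IntervalIntegrable (fun s => f s (x s)) volume t₁ t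
  eq_integral : ∀ t ∈ timeInterval t₁ ω, x t = x t₁ + ∫ s in t₁..t, f s (x s)

/-- A solution on `[t₁, ω)` that has no extension to a solution on a longer interval. -/
structure IsMaximalSolution (Ω : Set (ℝ × X)) (f : ℝ → X → X) (t₁ : ℝ) (ω : EReal)
    (x : ℝ → X) : Prop where
  isSolution : IsSolution Ω f t₁ ω x
  maximal : ∀ (ω₂ : EReal) (x₂ : ℝ → X), IsSolution Ω f t₁ ω₂ x₂ →
    Set.EqOn x₂ x (timeInterval t₁ ω) → ω₂ ≤ ω

/-- Measurable and locally essentially bounded inputs on `[t₁, ∞)`. -/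
def IsLocEssBounded (t₁ : ℝ) (u : ℝ → U) : Prop :=
  ∀ T, MemLp u ∞ (volume.restrict (Set.Icc t₁ T))

/-- The system `x' = f (t, x, u)` on the time axis `[t₀, ∞)` is ISS with `(β, γ)` for the set `A`:
for every initial time `t₁ ≥ t₀`, initial value and locally essentially bounded input there is a
global solution, and global solutions satisfy the ISS estimate. -/
structure IsISS (t₀ : ℝ) (f : ℝ → X → U → X) (β : ℝ → ℝ → ℝ) (γ : ℝ → ℝ) (A : Set X) :
    Prop where
  isClassKL : IsClassKL β
  isClassKInfty : IsClassKInfty γ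
  exists_global : ∀ t₁, t₀ ≤ t₁ → ∀ (x₁ : X) (u : ℝ → U), IsLocEssBounded t₁ u →
    ∃ x : ℝ → X, x t₁ = x₁ ∧ IsSolution Set.univ (fun t ξ => f t ξ (u t)) t₁ ⊤ x
  estimate : ∀ t₁, t₀ ≤ t₁ → ∀ (u : ℝ → U) (x : ℝ → X), IsLocEssBounded t₁ u →
    IsSolution Set.univ (fun t ξ => f t ξ (u t)) t₁ ⊤ x →
    ∀ t, t₁ ≤ t → Metric.infDist (x t) A ≤
      β (Metric.infDist (x t₁) A) (t - t₁) +
        γ (eLpNorm u ∞ (volume.restrict (Set.Ico t₁ t))).toReal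

end Systems

/-! ### Regularity of the vector fields -/

/-- `f : [t₀, ∞) × E → E₂` is measurable in `t`, locally Lipschitz in `x` (locally uniformly in
`t`), and bounded on compact sets of `x`, uniformly in `t`. -/
structure IsRegularField {E E₂ : Type*} [PseudoMetricSpace E] [NormedAddCommGroup E₂]
    (t₀ : ℝ) (f : ℝ → E → E₂) : Prop where
  measurable : ∀ x, AEStronglyMeasurable (fun t => f t x) (volume.restrict (Set.Ici t₀))
  lipschitz : ∀ K : Set E, IsCompact K → ∀ T : ℝ, ∃ L : NNReal, ∀ t ∈ Set.Icc t₀ T,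
    LipschitzOnWith L (f t) K
  bounded : ∀ K : Set E, IsCompact K → ∃ M : ℝ, ∀ t, t₀ ≤ t → ∀ x ∈ K, ‖f t x‖ ≤ M

/-! ### The multi-agent system -/

/-- The data of a heterogeneous multi-agent system with `N` agents, output dimension `m`, internal
dimensions `n i` and introspective output dimensions `q i`, together with a communication graph,
coupling functions `μ i j p` and performance functions `ψ i j p`.  All vector spaces `Fin k → ℝ`
carry the maximum norm. -/
structure MultiAgentSystem (N m : ℕ) (n q : Fin N → ℕ) where
  F : (i : Fin N) → ℝ → (Fin m → ℝ) → (Fin (n i) → ℝ) → (Fin m → ℝ)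
  Z : (i : Fin N) → ℝ → (Fin (n i) → ℝ) → (Fin m → ℝ) → (Fin (n i) → ℝ)
  Γ : (i : Fin N) → ℝ → (Fin (q i) → ℝ) → Matrix (Fin m) (Fin m) ℝ
  W : (i : Fin N) → (Fin m → ℝ) → (Fin (n i) → ℝ) → (Fin (q i) → ℝ)
  G : SimpleGraph (Fin N)
  μ : Fin N → Fin N → Fin m → ℝ → ℝ
  ψ : Fin N → Fin N → Fin m → ℝ → ℝ

/-- The tuple `(z₁, …, z_N)` of internal states. -/
abbrev Internal {N : ℕ} (n : Fin N → ℕ) : Type := (i : Fin N) → Fin (n i) → ℝ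

/-- The state `((y₁, …, y_N), (z₁, …, z_N))` of the closed loop. -/
abbrev NetworkState {N : ℕ} (m : ℕ) (n : Fin N → ℕ) : Type :=
  (Fin N → Fin m → ℝ) × Internal n

/-- The state `col (s, z₁, …, z_N)` of the (perturbed) blended dynamics; its norm is the
maximum norm. -/
abbrev BlendedState {N : ℕ} (m : ℕ) (n : Fin N → ℕ) : Type := (Fin m → ℝ) × Internal n

namespace MultiAgentSystem

variable {N m : ℕ} {n q : Fin N → ℕ} (S : MultiAgentSystem N m n q)

/-- The edge coupling `u_ij (t, ν)`. -/
noncomputable def edgeCoupling (i j : Fin N) (t : ℝ) (ν : Fin m → ℝ) : Fin m → ℝ :=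
  fun p => S.μ i j p (ν p / S.ψ i j p t)

open Classical in
/-- The edge-wise funnel coupling law `u_i`. -/
noncomputable def coupling (i : Fin N) (t : ℝ) (x : NetworkState m n) : Fin m → ℝ :=
  (S.Γ i t (S.W i (x.1 i) (x.2 i)))⁻¹ *ᵥ
    ∑ j : Fin N with S.G.Adj i j, S.edgeCoupling i j t (x.1 j - x.1 i)

/-- The right-hand side of the multi-agent system with the edge-wise funnel coupling law. -/
noncomputable def closedLoop (t : ℝ) (x : NetworkState m n) : NetworkState m n :=
  (fun i => S.F i t (x.1 i) (x.2 i) +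
      S.Γ i t (S.W i (x.1 i) (x.2 i)) *ᵥ S.coupling i t x,
   fun i => S.Z i t (x.2 i) (x.1 i))

/-- The funnel: the set where the coupling law is defined, since the coupling functions
are functions on `(-1, 1)`. -/
def funnel : Set (ℝ × NetworkState m n) :=
  {a | ∀ i j p, S.G.Adj i j → |a.2.1 j p - a.2.1 i p| < S.ψ i j p a.1}

/-- The right-hand side of the perturbed blended dynamics with input `e = (e₁, …, e_N)`. -/
noncomputable def blended (t : ℝ) (x : BlendedState m n) (e : Fin N → Fin m → ℝ) :
    BlendedState m n :=
  ((1 / (N : ℝ)) • ∑ i, S.F i t (x.1 + e i) (x.2 i),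
   fun i => S.Z i t (x.2 i) (x.1 + e i))

/-- `Ψ t`, the maximum of the performance functions over all edges and all components. -/
noncomputable def Psi (t : ℝ) : ℝ :=
  ⨆ a : {a : Fin N × Fin N × Fin m // S.G.Adj a.1 a.2.1}, S.ψ a.1.1 a.1.2.1 a.1.2.2 t

/-- `d_G Ψ(t)`, with `d_G` the diameter of the communication graph. -/
noncomputable def syncBound (t : ℝ) : ℝ := (S.G.diam : ℝ) * S.Psi t

section

attribute [local instance] Matrix.linftyOpNormedAddCommGroup

/-- Assumption on the open loop dynamics. -/
structure OpenLoopAssumption (t₀ : ℝ) : Prop where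
  F_regular : ∀ i, IsRegularField t₀
    (fun t (x : (Fin m → ℝ) × (Fin (n i) → ℝ)) => S.F i t x.1 x.2)
  Z_regular : ∀ i, IsRegularField t₀
    (fun t (x : (Fin m → ℝ) × (Fin (n i) → ℝ)) => S.Z i t x.2 x.1)
  Γ_regular : ∀ i, IsRegularField t₀ (S.Γ i)
  W_lipschitz : ∀ i, LocallyLipschitz
    (fun x : (Fin m → ℝ) × (Fin (n i) → ℝ) => S.W i x.1 x.2)

/-- Assumption on the gain matrices; the norm is the matrix norm induced by the maximum norm. -/
structure GainAssumption (t₀ : ℝ) : Prop where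
  invertible : ∀ i t w, t₀ ≤ t → IsUnit (S.Γ i t w)
  inv_bounded : ∃ M : ℝ, 0 < M ∧ ∀ i t w, t₀ ≤ t → ‖(S.Γ i t w)⁻¹‖ ≤ M

end

/-- Assumption on the design functions. -/
structure DesignAssumption (t₀ : ℝ) : Prop where
  ψ_pos : ∀ i j p, S.G.Adj i j → ∀ t, t₀ ≤ t → 0 < S.ψ i j p t
  ψ_bounded : ∀ i j p, S.G.Adj i j → ∃ M : ℝ, ∀ t, t₀ ≤ t → S.ψ i j p t ≤ M
  ψ_contDiffOn : ∀ i j p, S.G.Adj i j → ContDiffOn ℝ 1 (S.ψ i j p) (Set.Ici t₀)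
  ψ_deriv_bounded : ∀ i j p, S.G.Adj i j →
    ∃ M : ℝ, ∀ t, t₀ ≤ t → |derivWithin (S.ψ i j p) (Set.Ici t₀) t| ≤ M
  ψ_symm : ∀ i j p, S.G.Adj i j → ∀ t, t₀ ≤ t → S.ψ i j p t = S.ψ j i p t
  μ_continuousOn : ∀ i j p, S.G.Adj i j → ContinuousOn (S.μ i j p) (Set.Ioo (-1) 1)
  μ_tendsto_right : ∀ i j p, S.G.Adj i j → Tendsto (S.μ i j p) (𝓝[<] 1) atTop
  μ_tendsto_left : ∀ i j p, S.G.Adj i j → Tendsto (S.μ i j p) (𝓝[>] (-1)) atBot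
  μ_symm : ∀ i j p, S.G.Adj i j → ∀ r ∈ Set.Ioo (-1 : ℝ) 1, S.μ i j p (-r) = -S.μ j i p r

/-- Assumption that the perturbed blended dynamics has no finite escape time. -/
def NoFiniteEscape (t₀ : ℝ) : Prop :=
  ∀ t₁, t₀ ≤ t₁ → ∀ e : ℝ → Fin N → Fin m → ℝ,
    (∀ T, t₁ ≤ T → AbsolutelyContinuousOnInterval e t₁ T) →
    (∀ t, t₁ ≤ t → ∀ i, ‖e t i‖ ≤ S.syncBound t) →
    ∀ x₁ : BlendedState m n, ∃ x : ℝ → BlendedState m n,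
      x t₁ = x₁ ∧ IsSolution Set.univ (fun t ξ => S.blended t ξ (e t)) t₁ ⊤ x

end MultiAgentSystem

end FunnelCoupling

namespace FunnelCoupling

/-! ### Carathéodory differential equations -/

section Caratheodory

variable {X : Type*} [NormedAddCommGroup X] [NormedSpace ℝ X]

/-! The coupling forces on the two ends of an edge are opposite, so they cancel in the mean of the
outputs. The mean, together with the internal states, therefore solves the perturbed blended
dynamics, with the deviations of the outputs from their mean as input (`average_closedLoop`). Inside
the funnel a shortest path between two agents shows that this input is at most `d_G Ψ`.

Solutions are global. Suppose a maximal solution ends at a finite time `b`. By uniqueness its mean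
agrees with a global solution of the blended dynamics, so the closed loop solution is bounded
(`exists_norm_le_of_isSolution`). Pairing the output velocities with the outputs gives an energy
estimate: the coupling dissipates at least a multiple of the absolute edge forces, up to a constant.
As the energy is bounded, the velocity is integrable up to `b` and a limit exists
(`intervalIntegrable_closedLoop`).

The limit must lie strictly inside the funnel. In one component, orient every saturated edge from
its higher to its lower end. A node without a lower saturated neighbour has velocity bounded below,
so it exceeds its limit by at most `O(b - t)`. This bound climbs along saturated edges because the
funnel boundary is Lipschitz in time. At the highest node of a saturated edge, however, the velocity
tends to `-∞`, which contradicts the bound (`not_saturated`, `limit_mem_funnel`). Carathéodory–Peano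
then restarts the solution from the limit, against maximality.

For the estimate, the ISS bound up to time `t - T` confines the state to a radius `R` independent of
the solution and of `t₁`. Restarting there gives `β R T + γhat (D / w T)`, where `D` is the weighted
supremum. The infimum over `T` is nondecreasing in `D` and tends to zero with `D`, hence has a `K∞`
majorant, the required gain (`exists_fading_memory_gain`). Passing from the mean to a single output
costs `d_G Ψ(t)`. -/

/-- The vertices of the Euler polygon of step size `h` for `x' = f (t, x)`. -/
noncomputable def eulerVertex (f : ℝ → X → X) (a h : ℝ) (x₀ : X) : ℕ → X
  | 0 => x₀
  | j + 1 => eulerVertex f a h x₀ j +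
      ∫ s in (a + j * h)..(a + (j + 1 : ℕ) * h), f s (eulerVertex f a h x₀ j)

/-- The step function of the Euler polygon. -/
noncomputable def eulerStep (f : ℝ → X → X) (a h : ℝ) (x₀ : X) (s : ℝ) : X :=
  eulerVertex f a h x₀ ⌊(s - a) / h⌋₊

/-- The step function is constant on each of the countably many level sets of the floor function, so
measurability for frozen states suffices. -/
theorem eulerStep_aestronglyMeasurable {f : ℝ → X → X} {a h : ℝ} {x₀ : X}
    (hmeas : ∀ x, AEStronglyMeasurable (fun t => f t x) volume) :
    AEStronglyMeasurable (fun s => f s (eulerStep f a h x₀ s)) volume := by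
  have hfl : Measurable fun s : ℝ => ⌊(s - a) / h⌋₊ :=
    Nat.measurable_floor.comp ((measurable_id.sub_const a).div_const h)
  have hcov : (⋃ j : ℕ, {s : ℝ | ⌊(s - a) / h⌋₊ = j}) = Set.univ := by
    ext s; simp
  rw [← Measure.restrict_univ (μ := (volume : Measure ℝ)), ← hcov, aestronglyMeasurable_iUnion_iff]
  intro j
  refine ((hmeas (eulerVertex f a h x₀ j)).restrict).congr ?_
  refine (ae_restrict_iff' (hfl (measurableSet_singleton j))).2 (ae_of_all _ fun s hs => ?_)
  have hs' : ⌊(s - a) / h⌋₊ = j := hs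
  simp [eulerStep, hs']

theorem intervalIntegrable_of_norm_le {E : Type*} [NormedAddCommGroup E] {g : ℝ → E} {B : ℝ}
    (hg : AEStronglyMeasurable g volume) (hB : ∀ t, ‖g t‖ ≤ B) (c d : ℝ) :
    IntervalIntegrable g volume c d := by
  refine (intervalIntegrable_const (c := B)).mono_fun hg.restrict (ae_of_all _ fun t => ?_)
  exact (hB t).trans (Real.le_norm_self B)

/-- Each step adds the integral of the field with the state frozen, which makes sense for a field
merely measurable in time, and these integrals telescope. -/
theorem euler_integral_vertex {f : ℝ → X → X} {a h B : ℝ} (hh : 0 < h) {x₀ : X}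
    (hmeas : ∀ x, AEStronglyMeasurable (fun t => f t x) volume) (hB : ∀ t x, ‖f t x‖ ≤ B) (j : ℕ) :
    x₀ + ∫ s in a..(a + j * h), f s (eulerStep f a h x₀ s) = eulerVertex f a h x₀ j := by
  have hint : ∀ c d, IntervalIntegrable (fun s => f s (eulerStep f a h x₀ s)) volume c d :=
    intervalIntegrable_of_norm_le (eulerStep_aestronglyMeasurable hmeas) fun t => hB _ _
  induction j with
  | zero => simp [eulerVertex]
  | succ j ih =>
    rw [← intervalIntegral.integral_add_adjacent_intervals (hint a (a + j * h)) (hint _ _),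
      ← add_assoc, ih, eulerVertex]
    congr 1
    have hle : a + j * h ≤ a + (j + 1 : ℕ) * h := by push_cast; nlinarith
    -- At the right endpoint the floor has already jumped to `j + 1`; this single point is
    -- negligible.
    have hne : ∀ᵐ s : ℝ, s ≠ a + (j + 1 : ℕ) * h := Measure.ae_ne volume _
    refine intervalIntegral.integral_congr_ae ?_
    filter_upwards [hne] with s hs hmem
    rw [Set.uIoc_of_le hle] at hmem
    have h1 : (j : ℝ) ≤ (s - a) / h := by rw [le_div_iff₀ hh]; linarith [hmem.1]
    have h2 : (s - a) / h < j + 1 := by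
      rw [div_lt_iff₀ hh]
      have := lt_of_le_of_ne hmem.2 hs
      push_cast at this
      linarith
    have : ⌊(s - a) / h⌋₊ = j := by
      rw [Nat.floor_eq_iff ((Nat.cast_nonneg j).trans h1)]; exact ⟨h1, h2⟩
    simp [eulerStep, this]

theorem norm_integral_sub_le {g : ℝ → X} {B : ℝ} (hg : AEStronglyMeasurable g volume)
    (hB : ∀ t, ‖g t‖ ≤ B) (a c d : ℝ) :
    ‖(∫ s in a..d, g s) - ∫ s in a..c, g s‖ ≤ B * |d - c| := by
  have hint := intervalIntegrable_of_norm_le hg hB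
  rw [intervalIntegral.integral_interval_sub_left (hint a d) (hint a c)]
  exact intervalIntegral.norm_integral_le_of_norm_le_const fun t _ => hB t

/-- The polygon is `B`-Lipschitz and the step function holds its value at the last vertex, less than
`h` ago. -/
theorem euler_integral_sub_step {f : ℝ → X → X} {a h B : ℝ} (hh : 0 < h) {x₀ : X}
    (hmeas : ∀ x, AEStronglyMeasurable (fun t => f t x) volume) (hB : ∀ t x, ‖f t x‖ ≤ B)
    {t : ℝ} (ht : a ≤ t) :
    ‖(x₀ + ∫ s in a..t, f s (eulerStep f a h x₀ s)) - eulerStep f a h x₀ t‖ ≤ B * h := by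
  have hB0 : 0 ≤ B := (norm_nonneg _).trans (hB a x₀)
  rw [eulerStep, ← euler_integral_vertex hh hmeas hB, add_sub_add_left_eq_sub]
  refine (norm_integral_sub_le (eulerStep_aestronglyMeasurable hmeas) (fun t => hB _ _) _ _ _).trans
    (mul_le_mul_of_nonneg_left ?_ hB0)
  have h0 : 0 ≤ (t - a) / h := div_nonneg (by linarith) hh.le
  have h1 := Nat.floor_le h0
  have h2 := Nat.lt_floor_add_one ((t - a) / h)
  rw [le_div_iff₀ hh] at h1
  rw [div_lt_iff₀ hh] at h2
  rw [abs_le]; constructor <;> nlinarith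

/-- **Carathéodory–Peano** existence theorem for a globally defined bounded right-hand side. -/
theorem exists_solution_of_bounded [FiniteDimensional ℝ X] {f : ℝ → X → X} {B : ℝ}
    (hmeas : ∀ x, AEStronglyMeasurable (fun t => f t x) volume)
    (hcont : ∀ t, Continuous (f t)) (hB : ∀ t x, ‖f t x‖ ≤ B) (a b : ℝ) (hab : a ≤ b) (x₀ : X) :
    ∃ x : ℝ → X, ContinuousOn x (Set.Icc a b) ∧
      IntervalIntegrable (fun s => f s (x s)) volume a b ∧
      ∀ t ∈ Set.Icc a b, x t = x₀ + ∫ s in a..t, f s (x s) := by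
  have hB0 : 0 ≤ B := (norm_nonneg _).trans (hB a x₀)
  let h : ℕ → ℝ := fun k => 1 / ((k : ℝ) + 1)
  have hh : ∀ k, 0 < h k := fun k => by positivity
  have hh0 : Tendsto h atTop (𝓝 0) := tendsto_one_div_add_atTop_nhds_zero_nat
  let c : ℕ → ℝ → X := fun k => eulerStep f a (h k) x₀
  let g : ℕ → ℝ → X := fun k s => f s (c k s)
  have hgm : ∀ k, AEStronglyMeasurable (g k) volume := fun k => eulerStep_aestronglyMeasurable hmeas
  have hgB : ∀ k t, ‖g k t‖ ≤ B := fun k t => hB _ _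
  let ξ : ℕ → ℝ → X := fun k t => x₀ + ∫ s in a..t, g k s
  have hlip : ∀ k t u, dist (ξ k t) (ξ k u) ≤ B * |t - u| := by
    intro k t u
    rw [dist_eq_norm, add_sub_add_left_eq_sub]
    exact norm_integral_sub_le (hgm k) (hgB k) _ _ _
  have hξc : ∀ k, Continuous (ξ k) := fun k =>
    (LipschitzWith.of_dist_le_mul (K := ⟨B, hB0⟩) fun t u => hlip k t u).continuous
  let Ξ : ℕ → BoundedContinuousFunction (Set.Icc a b) X := fun k =>
    BoundedContinuousFunction.mkOfCompact ⟨fun t => ξ k t, (hξc k).comp continuous_subtype_val⟩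
  have hΞ : ∀ k (t : Set.Icc a b), Ξ k t = ξ k t := fun k t => rfl
  -- The polygons share a starting point and the Lipschitz constant `B`, so Arzelà–Ascoli applies.
  -- The step functions have the same limit, and dominated convergence passes to the limit in the
  -- integral equation.
  have hcomp : IsCompact (closure (Set.range Ξ)) := by
    refine BoundedContinuousFunction.arzela_ascoli (Metric.closedBall x₀ (B * (b - a)))
      (isCompact_closedBall _ _) _ ?_ ?_
    · rintro _ t ⟨k, rfl⟩
      rw [hΞ, Metric.mem_closedBall]
      have h1 := hlip k t a
      have h2 : ξ k a = x₀ := by simp [ξ]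
      rw [h2, abs_of_nonneg (by linarith [t.2.1])] at h1
      exact h1.trans (mul_le_mul_of_nonneg_left (by linarith [t.2.2]) hB0)
    · refine (LipschitzWith.uniformEquicontinuous _ ⟨B, hB0⟩ ?_).equicontinuous
      rintro ⟨_, k, rfl⟩
      exact LipschitzWith.of_dist_le_mul fun t u => hlip k t u
  obtain ⟨Y, -, φ, hφ, hY⟩ := hcomp.tendsto_subseq (x := Ξ) fun k => subset_closure ⟨k, rfl⟩
  let x : ℝ → X := fun t => Y (Set.projIcc a b hab t)
  have hxlim : ∀ t ∈ Set.Icc a b, Tendsto (fun k => ξ (φ k) t) atTop (𝓝 (x t)) := by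
    intro t ht
    have := (BoundedContinuousFunction.tendsto_iff_tendstoUniformly.1 hY).tendsto_at ⟨t, ht⟩
    simp only [x, Set.projIcc_of_mem hab ht]
    exact this
  have hclim : ∀ t ∈ Set.Icc a b, Tendsto (fun k => c (φ k) t) atTop (𝓝 (x t)) := by
    intro t ht
    have h1 : Tendsto (fun k => ξ (φ k) t - c (φ k) t) atTop (𝓝 0) := by
      refine squeeze_zero_norm (a := fun k => B * h (φ k))
        (fun k => euler_integral_sub_step (hh _) hmeas hB ht.1) ?_
      simpa using (hh0.comp hφ.tendsto_atTop).const_mul B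
    simpa using (hxlim t ht).sub h1
  have hglim : ∀ t ∈ Set.Icc a b, Tendsto (fun k => g (φ k) t) atTop (𝓝 (f t (x t))) :=
    fun t ht => ((hcont t).tendsto _).comp (hclim t ht)
  have hxm : AEStronglyMeasurable (fun s => f s (x s)) (volume.restrict (Set.Icc a b)) :=
    aestronglyMeasurable_of_tendsto_ae atTop (fun k => (hgm (φ k)).restrict)
      ((ae_restrict_iff' measurableSet_Icc).2 (ae_of_all _ hglim))
  refine ⟨x, ?_, ?_, fun t ht => ?_⟩
  · exact (Y.continuous.comp continuous_projIcc).continuousOn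
  · refine (intervalIntegrable_const (c := B)).mono_fun ?_ (ae_of_all _ fun t =>
      (hB _ _).trans (Real.le_norm_self B))
    rw [Set.uIoc_of_le hab]
    exact hxm.mono_measure (Measure.restrict_mono Set.Ioc_subset_Icc_self le_rfl)
  · refine tendsto_nhds_unique (hxlim t ht) (tendsto_const_nhds.add ?_)
    refine intervalIntegral.tendsto_integral_filter_of_dominated_convergence (fun _ => B)
      (Eventually.of_forall fun k => (hgm _).restrict)
      (Eventually.of_forall fun k => ae_of_all _ fun s _ => hgB _ _) intervalIntegrable_const
      (ae_of_all _ fun s hs => hglim s ?_)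
    rw [Set.uIoc_of_le ht.1] at hs
    exact ⟨hs.1.le, hs.2.trans ht.2⟩

/-- **Carathéodory–Peano** local existence theorem. -/
theorem exists_solution_of_closedBall [FiniteDimensional ℝ X] {f : ℝ → X → X} {a b r B : ℝ}
    {x₀ : X} (hab : a ≤ b) (hr : 0 < r) (hBr : B * (b - a) ≤ r)
    (hmeas : ∀ x ∈ Metric.closedBall x₀ r,
      AEStronglyMeasurable (fun t => f t x) (volume.restrict (Set.Icc a b)))
    (hcont : ∀ t ∈ Set.Icc a b, ContinuousOn (f t) (Metric.closedBall x₀ r))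
    (hB : ∀ t ∈ Set.Icc a b, ∀ x ∈ Metric.closedBall x₀ r, ‖f t x‖ ≤ B) :
    ∃ x : ℝ → X, (∀ t ∈ Set.Icc a b, x t ∈ Metric.closedBall x₀ r) ∧
      IntervalIntegrable (fun s => f s (x s)) volume a b ∧
      ∀ t ∈ Set.Icc a b, x t = x₀ + ∫ s in a..t, f s (x s) := by
  -- Radial retraction onto the ball. The field composed with it is globally bounded, and `B * (b -
  -- a) ≤ r` keeps its solution in the ball, where nothing was changed.
  let ρ : X → X := fun x => x₀ + (r / max r ‖x - x₀‖) • (x - x₀)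
  have hpos : ∀ x, 0 < max r ‖x - x₀‖ := fun x => lt_max_of_lt_left hr
  have hρc : Continuous ρ := by
    refine continuous_const.add (Continuous.smul (continuous_const.div (by fun_prop) ?_) (by fun_prop))
    exact fun x => (hpos x).ne'
  have hρm : ∀ x, ρ x ∈ Metric.closedBall x₀ r := by
    intro x
    rw [Metric.mem_closedBall, dist_eq_norm]
    simp only [ρ, add_sub_cancel_left, norm_smul, Real.norm_eq_abs]
    rw [abs_of_nonneg (div_nonneg hr.le (hpos x).le), div_mul_eq_mul_div, div_le_iff₀ (hpos x)]
    exact mul_le_mul_of_nonneg_left (le_max_right _ _) hr.le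
  have hρid : ∀ x ∈ Metric.closedBall x₀ r, ρ x = x := by
    intro x hx
    rw [Metric.mem_closedBall, dist_eq_norm] at hx
    simp [ρ, max_eq_left hx, hr.ne']
  have hx₀ : x₀ ∈ Metric.closedBall x₀ r := Metric.mem_closedBall_self hr.le
  have hB0 : 0 ≤ B := (norm_nonneg _).trans (hB a ⟨le_rfl, hab⟩ x₀ hx₀)
  let F : ℝ → X → X := fun t x => (Set.Icc a b).indicator (fun s => f s (ρ x)) t
  have hF : ∀ t ∈ Set.Icc a b, ∀ x, F t x = f t (ρ x) := fun t ht x =>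
    Set.indicator_of_mem ht _
  have hF' : ∀ t ∉ Set.Icc a b, ∀ x, F t x = 0 := fun t ht x => Set.indicator_of_notMem ht _
  have hFB : ∀ t x, ‖F t x‖ ≤ B := by
    intro t x
    by_cases ht : t ∈ Set.Icc a b
    · rw [hF t ht]; exact hB t ht _ (hρm x)
    · rw [hF' t ht, norm_zero]; exact hB0
  obtain ⟨x, -, hxi, hx⟩ := exists_solution_of_bounded (f := F) (B := B)
    (fun x => (aestronglyMeasurable_indicator_iff measurableSet_Icc).2 (hmeas _ (hρm x)))
    (fun t => by
      by_cases ht : t ∈ Set.Icc a b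
      · have : F t = fun x => f t (ρ x) := funext (hF t ht)
        rw [this]
        exact (hcont t ht).comp_continuous hρc hρm
      · have : F t = fun _ => 0 := funext (hF' t ht)
        rw [this]
        exact continuous_const) hFB a b hab x₀
  have hball : ∀ t ∈ Set.Icc a b, x t ∈ Metric.closedBall x₀ r := by
    intro t ht
    rw [Metric.mem_closedBall, dist_eq_norm, hx t ht, add_sub_cancel_left]
    refine (intervalIntegral.norm_integral_le_of_norm_le_const fun s _ => hFB s _).trans ?_
    rw [abs_of_nonneg (by linarith [ht.1])]
    exact (mul_le_mul_of_nonneg_left (by linarith [ht.2]) hB0).trans hBr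
  have heq : ∀ t ∈ Set.Icc a b, F t (x t) = f t (x t) := fun t ht => by
    rw [hF t ht, hρid _ (hball t ht)]
  refine ⟨x, hball, hxi.congr fun s hs => ?_, fun t ht => ?_⟩
  · rw [Set.uIoc_of_le hab] at hs
    exact heq s ⟨hs.1.le, hs.2⟩
  · rw [hx t ht]
    congr 1
    refine intervalIntegral.integral_congr fun s hs => ?_
    rw [Set.uIcc_of_le ht.1] at hs
    exact heq s ⟨hs.1, hs.2.trans ht.2⟩

/-- Uniqueness of Carathéodory solutions in a set where the right-hand side is Lipschitz. -/
theorem eqOn_of_lipschitzOnWith {f : ℝ → X → X} {a b : ℝ} {K : Set X} {L : NNReal}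
    (hL : ∀ t ∈ Set.Icc a b, LipschitzOnWith L (f t) K) {x y : ℝ → X} {x₀ : X}
    (hxc : ContinuousOn x (Set.Icc a b)) (hyc : ContinuousOn y (Set.Icc a b))
    (hxK : ∀ t ∈ Set.Icc a b, x t ∈ K) (hyK : ∀ t ∈ Set.Icc a b, y t ∈ K)
    (hxi : ∀ t ∈ Set.Icc a b, IntervalIntegrable (fun s => f s (x s)) volume a t)
    (hyi : ∀ t ∈ Set.Icc a b, IntervalIntegrable (fun s => f s (y s)) volume a t)
    (hx : ∀ t ∈ Set.Icc a b, x t = x₀ + ∫ s in a..t, f s (x s))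
    (hy : ∀ t ∈ Set.Icc a b, y t = x₀ + ∫ s in a..t, f s (y s)) :
    Set.EqOn x y (Set.Icc a b) := by
  rcases le_or_gt a b with hab | hab
  swap
  · simp [Set.Icc_eq_empty_of_lt hab]
  let v : ℝ → ℝ := fun t => ‖x t - y t‖
  let u : ℝ → ℝ := Set.IccExtend hab (fun t : Set.Icc a b => v t)
  have huc : Continuous u := by
    refine Continuous.Icc_extend' ?_
    exact continuousOn_iff_continuous_domRestrict.1 (hxc.sub hyc).norm
  have huv : ∀ t ∈ Set.Icc a b, u t = ‖x t - y t‖ := fun t ht => Set.IccExtend_of_mem hab _ ht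
  -- The distance of the solutions need not be differentiable, so Grönwall is applied to its
  -- primitive.
  let U : ℝ → ℝ := fun t => ∫ s in a..t, u s
  have hU : ∀ t, HasDerivAt U (u t) t := fun t =>
    intervalIntegral.integral_hasDerivAt_right (huc.intervalIntegrable _ _)
      (huc.stronglyMeasurableAtFilter _ _) huc.continuousAt
  have hle : ∀ t ∈ Set.Icc a b, u t ≤ L * U t := by
    intro t ht
    rw [huv t ht, hx t ht, hy t ht, add_sub_add_left_eq_sub,
      ← intervalIntegral.integral_sub (hxi t ht) (hyi t ht), ← intervalIntegral.integral_const_mul]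
    refine intervalIntegral.norm_integral_le_of_norm_le ht.1 (ae_of_all _ fun s hs => ?_)
      ((huc.const_smul (L : ℝ)).intervalIntegrable _ _)
    have hs' : s ∈ Set.Icc a b := ⟨hs.1.le, hs.2.trans ht.2⟩
    rw [huv s hs']
    exact (hL s hs').norm_sub_le (hxK s hs') (hyK s hs')
  have hu0 : ∀ t ∈ Set.Icc a b, 0 ≤ u t := fun t ht => by rw [huv t ht]; exact norm_nonneg _
  have hU0 : ∀ t ∈ Set.Icc a b, U t ≤ gronwallBound 0 L 0 (t - a) := by
    refine le_gronwallBound_of_liminf_deriv_right_le (f' := u)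
      (fun t _ => (hU t).continuousAt.continuousWithinAt)
      (fun t ht r hr => (hU t).hasDerivWithinAt.liminf_right_slope_le hr) (by simp [U])
      (fun t ht => by simpa using hle t ⟨ht.1, ht.2.le⟩)
  intro t ht
  have h1 := hU0 t ht
  rw [gronwallBound_ε0_δ0] at h1
  have h2 : ‖x t - y t‖ ≤ 0 := by
    rw [← huv t ht]
    exact (hle t ht).trans (mul_nonpos_of_nonneg_of_nonpos L.2 h1)
  exact sub_eq_zero.1 (norm_le_zero_iff.1 h2)

end Caratheodory

/-- The energy identity for a primitive. -/
theorem integral_primitive_mul {y g : ℝ → ℝ} {a b : ℝ} (hab : a ≤ b)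
    (hg : IntervalIntegrable g volume a b)
    (hy : ∀ t ∈ Set.Icc a b, y t = y a + ∫ s in a..t, g s) :
    ∫ t in a..b, y t * g t = (y b ^ 2 - y a ^ 2) / 2 := by
  let Y : ℝ → ℝ := fun t => y a + ∫ s in a..t, g s
  have hYac : AbsolutelyContinuousOnInterval Y a b :=
    ((LipschitzWith.const (y a)).lipschitzOnWith (s := Set.uIcc a b)
      |>.absolutelyContinuousOnInterval).add
      (hg.absolutelyContinuousOnInterval_intervalIntegral Set.left_mem_uIcc)
  have hd : ∀ᵐ t, t ∈ Set.uIcc a b → HasDerivAt Y (g t) t := by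
    filter_upwards [hg.ae_hasDerivAt_integral] with t ht hmem
    exact (ht hmem a Set.left_mem_uIcc).const_add _
  have key := hYac.integral_deriv_mul_eq_sub hYac
  have hcongr : ∫ t in a..b, deriv Y t * Y t + Y t * deriv Y t = ∫ t in a..b, 2 * (y t * g t) := by
    refine intervalIntegral.integral_congr_ae ?_
    filter_upwards [hd] with t ht hmem
    have hm := Set.uIoc_subset_uIcc hmem
    rw [(ht hm).deriv]
    rw [Set.uIcc_of_le hab] at hm
    rw [hy t hm]
    ring
  rw [hcongr, intervalIntegral.integral_const_mul] at key
  have hYa : Y a = y a := by simp [Y]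
  have hYb : Y b = y b := (hy b ⟨hab, le_rfl⟩).symm
  rw [hYa, hYb] at key
  linarith

/-! ### Comparison functions -/

/-- A nondecreasing function that tends to zero at zero has a majorant of class `K∞`. -/
theorem exists_isClassKInfty_ge {g : ℝ → ℝ} (hmono : MonotoneOn g (Set.Ici 0))
    (hpos : ∀ r, 0 ≤ r → 0 ≤ g r) (hzero : ∀ ε, 0 < ε → ∃ r, 0 < r ∧ g r < ε) :
    ∃ γ, IsClassKInfty γ ∧ ∀ r, 0 ≤ r → g r ≤ γ r := by
  let k : ℝ → ℝ := fun r => g (max r 0)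
  have hk : Monotone k := fun r s hrs =>
    hmono (Set.mem_Ici.2 (le_max_right _ _)) (Set.mem_Ici.2 (le_max_right _ _))
      (max_le_max_right 0 hrs)
  have hkg : ∀ r, 0 ≤ r → k r = g r := fun r hr => by simp [k, max_eq_left hr]
  have hki : ∀ c d, IntervalIntegrable k volume c d := fun c d => hk.intervalIntegrable
  have hg0 : g 0 = 0 := by
    refine le_antisymm (le_of_forall_pos_le_add fun ε hε => ?_) (hpos 0 le_rfl)
    obtain ⟨r, hr, hrε⟩ := hzero ε hε
    linarith [hmono (Set.self_mem_Ici) hr.le hr.le]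
  -- Averaging over `[r, 2r]` makes the function continuous for `r > 0` while `g r ≤ J r ≤ g (2 *
  -- r)`; the upper bound gives continuity at zero.
  let J : ℝ → ℝ := fun r => ∫ u in (1 : ℝ)..2, k (r * u)
  have hJi : ∀ r, 0 ≤ r → IntervalIntegrable (fun u => k (r * u)) volume 1 2 := fun r hr =>
    (hk.comp (fun u v huv => mul_le_mul_of_nonneg_left huv hr)).intervalIntegrable
  have hJmono : ∀ r s, 0 ≤ r → r ≤ s → J r ≤ J s := fun r s hr hrs =>
    intervalIntegral.integral_mono_on one_le_two (hJi r hr) (hJi s (hr.trans hrs)) fun u hu =>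
      hk (mul_le_mul_of_nonneg_right hrs (by linarith [hu.1]))
  have hJle : ∀ r, 0 ≤ r → J r ≤ g (2 * r) := by
    intro r hr
    have : J r ≤ ∫ _ in (1 : ℝ)..2, k (2 * r) :=
      intervalIntegral.integral_mono_on one_le_two (hJi r hr) intervalIntegrable_const fun u hu =>
        hk (by nlinarith [hu.2])
    rw [← hkg (2 * r) (by linarith)]
    rw [intervalIntegral.integral_const] at this
    norm_num at this
    exact this
  have hleJ : ∀ r, 0 ≤ r → g r ≤ J r := by
    intro r hr
    have : (∫ _ in (1 : ℝ)..2, k r) ≤ J r :=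
      intervalIntegral.integral_mono_on one_le_two intervalIntegrable_const (hJi r hr) fun u hu =>
        hk (by nlinarith [hu.1])
    rw [← hkg r hr]
    rw [intervalIntegral.integral_const] at this
    norm_num at this
    exact this
  have hJ0 : J 0 = 0 := le_antisymm (by simpa [hg0] using hJle 0 le_rfl)
    (by simpa [hg0] using hleJ 0 le_rfl)
  have hJnn : ∀ r, 0 ≤ r → 0 ≤ J r := fun r hr => (hpos r hr).trans (hleJ r hr)
  have hJc : ContinuousOn J (Set.Ici 0) := by
    intro r hr
    rcases eq_or_lt_of_le (show (0 : ℝ) ≤ r from hr) with rfl | hr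
    · rw [Metric.continuousWithinAt_iff]
      intro ε hε
      obtain ⟨r, hr, hrε⟩ := hzero ε hε
      refine ⟨r / 2, by positivity, fun {s} hs hd => ?_⟩
      have hs' : (0 : ℝ) ≤ s := hs
      rw [Real.dist_eq, sub_zero, abs_of_nonneg hs'] at hd
      rw [hJ0, Real.dist_eq, sub_zero, abs_of_nonneg (hJnn s hs)]
      refine (hJle s hs).trans_lt (lt_of_le_of_lt (hmono ?_ hr.le (by linarith)) hrε)
      exact Set.mem_Ici.2 (by linarith)
    · have hP : Continuous fun r => ∫ u in (0 : ℝ)..r, k u :=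
        intervalIntegral.continuous_primitive hki 0
      have hev : J =ᶠ[𝓝 r] fun r => r⁻¹ * ((∫ u in (0 : ℝ)..(r * 2), k u)
          - ∫ u in (0 : ℝ)..(r * 1), k u) := by
        filter_upwards [lt_mem_nhds hr] with s hs
        simp only [J]
        rw [intervalIntegral.integral_comp_mul_left (fun u => k u) hs.ne',
          intervalIntegral.integral_interval_sub_left (hki _ _) (hki _ _), smul_eq_mul]
      refine (ContinuousAt.congr ?_ hev.symm).continuousWithinAt
      refine (continuousAt_inv₀ hr.ne').mul (Continuous.continuousAt ?_)
      exact (hP.comp (continuous_id.mul continuous_const)).sub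
        (hP.comp (continuous_id.mul continuous_const))
  -- The summand `r` supplies strict monotonicity and unboundedness.
  refine ⟨fun r => r + J r, ⟨⟨continuousOn_id.add hJc, ?_, by simp [hJ0]⟩, ?_⟩, ?_⟩
  · intro r hr s hs hrs
    exact add_lt_add_of_lt_of_le hrs (hJmono r s hr hrs.le)
  · refine tendsto_atTop_mono' atTop ?_ tendsto_id
    filter_upwards [eventually_ge_atTop 0] with r hr
    simpa using hJnn r hr
  · intro r hr
    exact (hleJ r hr).trans (le_add_of_nonneg_left hr)

/-! ### Basic properties of solutions -/

section Solutions

variable {X : Type*} [NormedAddCommGroup X] [NormedSpace ℝ X] {Ω : Set (ℝ × X)} {f : ℝ → X → X}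
  {t₁ : ℝ} {ω : EReal} {x : ℝ → X}

theorem mem_timeInterval_of_le {s t : ℝ} (ht : t ∈ timeInterval t₁ ω) (h₁ : t₁ ≤ s) (h₂ : s ≤ t) :
    s ∈ timeInterval t₁ ω :=
  ⟨h₁, (EReal.coe_le_coe_iff.2 h₂).trans_lt ht.2⟩

theorem mem_timeInterval_coe {b t : ℝ} : t ∈ timeInterval t₁ (b : EReal) ↔ t ∈ Set.Ico t₁ b := by
  simp [timeInterval]

theorem mem_timeInterval_top {t : ℝ} : t ∈ timeInterval t₁ ⊤ ↔ t₁ ≤ t := by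
  simp [timeInterval, EReal.coe_lt_top]

theorem IsSolution.integrable_of_le (hx : IsSolution Ω f t₁ ω x) {s t : ℝ} (h₁ : t₁ ≤ s)
    (hst : s ≤ t) (ht : t ∈ timeInterval t₁ ω) :
    IntervalIntegrable (fun r => f r (x r)) volume s t :=
  (hx.integrable s (mem_timeInterval_of_le ht h₁ hst)).symm.trans (hx.integrable t ht)

theorem IsSolution.eq_add_integral (hx : IsSolution Ω f t₁ ω x) {s t : ℝ} (h₁ : t₁ ≤ s)
    (hst : s ≤ t) (ht : t ∈ timeInterval t₁ ω) :
    x t = x s + ∫ r in s..t, f r (x r) := by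
  have hs := mem_timeInterval_of_le ht h₁ hst
  rw [hx.eq_integral t ht, hx.eq_integral s hs, add_assoc,
    intervalIntegral.integral_add_adjacent_intervals (hx.integrable s hs)
      (hx.integrable_of_le h₁ hst ht)]

theorem IsSolution.continuousOn_Icc (hx : IsSolution Ω f t₁ ω x) {T : ℝ}
    (hT : T ∈ timeInterval t₁ ω) : ContinuousOn x (Set.Icc t₁ T) := by
  have h := intervalIntegral.continuousOn_primitive_interval' (hx.integrable T hT) Set.left_mem_uIcc
  rw [Set.uIcc_of_le hT.1] at h
  exact (continuousOn_const.add h).congr fun t ht =>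
    hx.eq_integral t (mem_timeInterval_of_le hT ht.1 ht.2)

/-- A global solution restarted at a later time. -/
theorem IsSolution.restart (hx : IsSolution Ω f t₁ ⊤ x) {t₂ : ℝ} (h : t₁ ≤ t₂) :
    IsSolution Ω f t₂ ⊤ x where
  lt := EReal.coe_lt_top _
  mem_domain t ht := hx.mem_domain t ⟨h.trans ht.1, ht.2⟩
  integrable _ ht := hx.integrable_of_le h ht.1 ⟨h.trans ht.1, ht.2⟩
  eq_integral _ ht := hx.eq_add_integral h ht.1 ⟨h.trans ht.1, ht.2⟩

/-- The continuous linear image of a solution. -/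
theorem IsSolution.map [CompleteSpace X] {Y : Type*} [NormedAddCommGroup Y] [NormedSpace ℝ Y]
    [CompleteSpace Y]
    (hx : IsSolution Ω f t₁ ω x) (P : X →L[ℝ] Y) {g : ℝ → Y → Y}
    (hg : ∀ t ∈ timeInterval t₁ ω, P (f t (x t)) = g t (P (x t))) :
    IsSolution Set.univ g t₁ ω (fun t => P (x t)) where
  lt := hx.lt
  mem_domain _ _ := Set.mem_univ _
  integrable t ht := by
    have h := hx.integrable t ht
    refine IntervalIntegrable.congr (f := fun s => P (f s (x s))) ?_ ?_
    · intro s hs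
      rw [Set.uIoc_of_le ht.1] at hs
      exact hg s (mem_timeInterval_of_le ht hs.1.le hs.2)
    · exact ⟨P.integrable_comp h.1, P.integrable_comp h.2⟩
  eq_integral t ht := by
    rw [hx.eq_integral t ht, map_add, ← P.intervalIntegral_comp_comm (hx.integrable t ht)]
    congr 1
    refine intervalIntegral.integral_congr fun s hs => ?_
    rw [Set.uIcc_of_le ht.1] at hs
    exact hg s (mem_timeInterval_of_le ht hs.1 hs.2)

end Solutions

namespace MultiAgentSystem

variable {N m : ℕ} {n q : Fin N → ℕ} {S : MultiAgentSystem N m n q} {t₀ : ℝ}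

/-! ### The closed loop and the blended dynamics -/

open Classical in
/-- The coupling force that agent `j` exerts on component `p` of agent `i`. -/
noncomputable def edgeForce (S : MultiAgentSystem N m n q) (t : ℝ) (x : NetworkState m n)
    (p : Fin m) (i j : Fin N) : ℝ :=
  if S.G.Adj i j then S.μ i j p ((x.1 j p - x.1 i p) / S.ψ i j p t) else 0

theorem edgeForce_of_adj {t : ℝ} {x : NetworkState m n} {p : Fin m} {i j : Fin N}
    (h : S.G.Adj i j) :
    S.edgeForce t x p i j = S.μ i j p ((x.1 j p - x.1 i p) / S.ψ i j p t) := if_pos h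

theorem edgeForce_of_not_adj {t : ℝ} {x : NetworkState m n} {p : Fin m} {i j : Fin N}
    (h : ¬ S.G.Adj i j) : S.edgeForce t x p i j = 0 := if_neg h

/-- The gain cancels against its inverse in the control law, so only plain edge forces act on the
outputs. -/
theorem closedLoop_fst_apply (hGain : S.GainAssumption t₀) {t : ℝ} (ht : t₀ ≤ t)
    (x : NetworkState m n) (i : Fin N) (p : Fin m) :
    (S.closedLoop t x).1 i p = S.F i t (x.1 i) (x.2 i) p + ∑ j, S.edgeForce t x p i j := by
  have hu := (Matrix.isUnit_iff_isUnit_det _).1 (hGain.invertible i t (S.W i (x.1 i) (x.2 i)) ht)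
  simp only [closedLoop, coupling, Matrix.mulVec_mulVec, Matrix.mul_nonsing_inv _ hu,
    Matrix.one_mulVec, Pi.add_apply, Finset.sum_filter, Finset.sum_apply, edgeForce]
  refine congrArg _ (Finset.sum_congr rfl fun j _ => ?_)
  split_ifs <;> simp [edgeCoupling]

theorem div_mem_Ioo_of_mem_funnel (hDesign : S.DesignAssumption t₀) {t : ℝ} (ht : t₀ ≤ t)
    {x : NetworkState m n} (hx : (t, x) ∈ S.funnel) {i j : Fin N} (h : S.G.Adj i j) (p : Fin m) :
    (x.1 j p - x.1 i p) / S.ψ i j p t ∈ Set.Ioo (-1 : ℝ) 1 := by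
  have hψ := hDesign.ψ_pos i j p h t ht
  have := abs_lt.1 (hx i j p h)
  constructor
  · rw [lt_div_iff₀ hψ]; linarith [this.1]
  · rw [div_lt_iff₀ hψ]; linarith [this.2]

/-- Action equals reaction: this gives both the cancellation in the mean and the symmetrised energy
identity. -/
theorem edgeForce_antisymm (hDesign : S.DesignAssumption t₀) {t : ℝ} (ht : t₀ ≤ t)
    {x : NetworkState m n} (hx : (t, x) ∈ S.funnel) (p : Fin m) (i j : Fin N) :
    S.edgeForce t x p i j = - S.edgeForce t x p j i := by
  by_cases h : S.G.Adj i j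
  · rw [edgeForce_of_adj h, edgeForce_of_adj h.symm,
      ← hDesign.μ_symm i j p h _ (div_mem_Ioo_of_mem_funnel hDesign ht hx h.symm p),
      hDesign.ψ_symm i j p h t ht, ← neg_div, neg_sub]
  · rw [edgeForce_of_not_adj h, edgeForce_of_not_adj fun h' => h h'.symm, neg_zero]

theorem sum_edgeForce (hDesign : S.DesignAssumption t₀) {t : ℝ} (ht : t₀ ≤ t)
    {x : NetworkState m n} (hx : (t, x) ∈ S.funnel) (p : Fin m) :
    ∑ i, ∑ j, S.edgeForce t x p i j = 0 := by
  have h : ∑ i, ∑ j, S.edgeForce t x p i j = - ∑ i, ∑ j, S.edgeForce t x p i j := by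
    conv_lhs => rw [Finset.sum_comm]
    simp_rw [← Finset.sum_neg_distrib]
    exact Finset.sum_congr rfl fun i _ => Finset.sum_congr rfl fun j _ =>
      edgeForce_antisymm hDesign ht hx p j i
  linarith

/-- The map `(y, z) ↦ (N⁻¹ ∑ yᵢ, z)`. -/
noncomputable def average (m : ℕ) (n : Fin N → ℕ) : NetworkState m n →L[ℝ] BlendedState m n :=
  ((1 / (N : ℝ)) • ∑ i, ContinuousLinearMap.proj i ∘L ContinuousLinearMap.fst ℝ _ _).prod
    (ContinuousLinearMap.snd ℝ _ _)

theorem average_apply (x : NetworkState m n) :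
    average m n x = ((1 / (N : ℝ)) • ∑ i, x.1 i, x.2) := by
  simp [average]

/-- The deviation of the outputs from their mean. -/
noncomputable def deviation (x : NetworkState m n) (i : Fin N) : Fin m → ℝ :=
  x.1 i - (average m n x).1

theorem continuous_deviation : Continuous (deviation (m := m) (n := n)) := by
  unfold deviation
  fun_prop

theorem average_closedLoop (hGain : S.GainAssumption t₀) (hDesign : S.DesignAssumption t₀)
    {t : ℝ} (ht : t₀ ≤ t) {x : NetworkState m n} (hx : (t, x) ∈ S.funnel) :
    average m n (S.closedLoop t x) = S.blended t (average m n x) (deviation x) := by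
  rw [average_apply, blended]
  have h : ∀ i, (average m n x).1 + deviation x i = x.1 i := fun i => by simp [deviation]
  simp only [h]
  refine Prod.ext ?_ ?_
  · refine congrArg (fun v => (1 / (N : ℝ)) • v) (funext fun p => ?_)
    simp only [Finset.sum_apply, closedLoop_fst_apply hGain ht, Finset.sum_add_distrib,
      sum_edgeForce hDesign ht hx p, add_zero]
    simp [average_apply]
  · funext i
    simp [closedLoop, average_apply]

/-! ### Synchronization bound inside the funnel -/

theorem psi_le_Psi {i j : Fin N} (h : S.G.Adj i j) (p : Fin m) (t : ℝ) :
    S.ψ i j p t ≤ S.Psi t :=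
  le_ciSup (f := fun a : {a : Fin N × Fin N × Fin m // S.G.Adj a.1 a.2.1} =>
    S.ψ a.1.1 a.1.2.1 a.1.2.2 t) (Set.finite_range _).bddAbove ⟨(i, j, p), h⟩

theorem Psi_nonneg (hDesign : S.DesignAssumption t₀) {t : ℝ} (ht : t₀ ≤ t) : 0 ≤ S.Psi t :=
  Real.iSup_nonneg fun a => (hDesign.ψ_pos _ _ _ a.2 t ht).le

theorem syncBound_nonneg (hDesign : S.DesignAssumption t₀) {t : ℝ} (ht : t₀ ≤ t) :
    0 ≤ S.syncBound t :=
  mul_nonneg (Nat.cast_nonneg _) (Psi_nonneg hDesign ht)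

theorem exists_syncBound_le (hDesign : S.DesignAssumption t₀) :
    ∃ P : ℝ, 0 ≤ P ∧ ∀ t, t₀ ≤ t → S.syncBound t ≤ P := by
  classical
  choose B hB using fun a : {a : Fin N × Fin N × Fin m // S.G.Adj a.1 a.2.1} =>
    hDesign.ψ_bounded a.1.1 a.1.2.1 a.1.2.2 a.2
  have hle : ∀ t, t₀ ≤ t → S.Psi t ≤ ∑ a, |B a| := by
    intro t ht
    refine Real.iSup_le (fun a => (hB a t ht).trans ((le_abs_self _).trans ?_))
      (Finset.sum_nonneg fun a _ => abs_nonneg _)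
    exact Finset.single_le_sum (f := fun a => |B a|) (fun a _ => abs_nonneg _) (Finset.mem_univ a)
  exact ⟨S.G.diam * ∑ a, |B a|,
    mul_nonneg (Nat.cast_nonneg _) (Finset.sum_nonneg fun a _ => abs_nonneg _),
    fun t ht => mul_le_mul_of_nonneg_left (hle t ht) (Nat.cast_nonneg _)⟩

/-- Triangle inequality along the walk, each edge contributing less than its funnel width. -/
theorem abs_sub_le_length_mul_Psi {t : ℝ} {x : NetworkState m n} (hx : (t, x) ∈ S.funnel)
    (p : Fin m) {i j : Fin N} (c : S.G.Walk i j) :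
    |x.1 j p - x.1 i p| ≤ c.length * S.Psi t := by
  induction c with
  | nil => simp
  | cons h c ih =>
    rw [SimpleGraph.Walk.length_cons]
    push_cast
    have h1 := (hx _ _ p h).le.trans (psi_le_Psi h p t)
    calc _ = |(x.1 _ p - x.1 _ p) + (x.1 _ p - x.1 _ p)| := by rw [sub_add_sub_cancel]
      _ ≤ _ := (abs_add_le _ _).trans (add_le_add ih h1)
      _ = _ := by ring

theorem abs_sub_le_syncBound (hGraph : S.G.Connected) (hDesign : S.DesignAssumption t₀) {t : ℝ}
    (ht : t₀ ≤ t) {x : NetworkState m n} (hx : (t, x) ∈ S.funnel) (p : Fin m) (i j : Fin N) :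
    |x.1 j p - x.1 i p| ≤ S.syncBound t := by
  obtain ⟨c, hc⟩ := (hGraph.preconnected i j).exists_walk_length_eq_dist
  refine (abs_sub_le_length_mul_Psi hx p c).trans ?_
  have := hGraph.nonempty
  -- `diam` would default to `0` for an infinite extended diameter; connectedness of the finite
  -- graph excludes this.
  have hd : c.length ≤ S.G.diam :=
    hc ▸ SimpleGraph.dist_le_diam (SimpleGraph.connected_iff_ediam_ne_top.1 hGraph)
  exact mul_le_mul_of_nonneg_right (Nat.cast_le.2 hd) (Psi_nonneg hDesign ht)

theorem norm_deviation_le (hGraph : S.G.Connected) (hDesign : S.DesignAssumption t₀) {t : ℝ}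
    (ht : t₀ ≤ t) {x : NetworkState m n} (hx : (t, x) ∈ S.funnel) (i : Fin N) :
    ‖deviation x i‖ ≤ S.syncBound t := by
  refine (pi_norm_le_iff_of_nonneg (syncBound_nonneg hDesign ht)).2 fun p => ?_
  have hN : (0 : ℝ) < N := by
    have := hGraph.nonempty
    exact Nat.cast_pos.2 (Fin.pos_iff_nonempty.2 this)
  have h : deviation x i p = (1 / (N : ℝ)) * ∑ j, (x.1 i p - x.1 j p) := by
    simp [deviation, average_apply, Finset.sum_sub_distrib, mul_sub, hN.ne']
  rw [h, Real.norm_eq_abs, abs_mul, abs_of_pos (by positivity : 0 < 1 / (N : ℝ)), div_mul_eq_mul_div,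
    one_mul, div_le_iff₀ hN]
  refine (Finset.abs_sum_le_sum_abs _ _).trans
    ((Finset.sum_le_sum fun j _ => abs_sub_le_syncBound hGraph hDesign ht hx p j i).trans ?_)
  simp [mul_comm]

theorem norm_deviation_le' (hGraph : S.G.Connected) (hDesign : S.DesignAssumption t₀) {t : ℝ}
    (ht : t₀ ≤ t) {x : NetworkState m n} (hx : (t, x) ∈ S.funnel) :
    ‖deviation x‖ ≤ S.syncBound t :=
  (pi_norm_le_iff_of_nonneg (syncBound_nonneg hDesign ht)).2 (norm_deviation_le hGraph hDesign ht hx)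

/-- The mean of a closed loop solution solves the perturbed blended dynamics. -/
theorem isSolution_average (hGain : S.GainAssumption t₀) (hDesign : S.DesignAssumption t₀)
    {t₁ : ℝ} (ht₁ : t₀ ≤ t₁) {ω : EReal} {x : ℝ → NetworkState m n}
    (hx : IsSolution S.funnel S.closedLoop t₁ ω x) {e : ℝ → Fin N → Fin m → ℝ}
    (he : ∀ t ∈ timeInterval t₁ ω, e t = deviation (x t)) :
    IsSolution Set.univ (fun t ξ => S.blended t ξ (e t)) t₁ ω (fun t => average m n (x t)) :=
  hx.map _ fun t ht => by
    rw [he t ht]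
    exact average_closedLoop hGain hDesign (ht₁.trans ht.1) (hx.mem_domain t ht)

/-! ### A priori bounds for the closed loop -/

/-- The perturbed blended dynamics is Lipschitz on bounded sets. -/
theorem exists_lipschitzOnWith_blended (hOpen : S.OpenLoopAssumption t₀) (ρ P T : ℝ) :
    ∃ L : NNReal, ∀ t ∈ Set.Icc t₀ T, ∀ e : Fin N → Fin m → ℝ, ‖e‖ ≤ P →
      LipschitzOnWith L (fun ξ => S.blended t ξ e) (Metric.closedBall 0 ρ) := by
  choose LF hLF using fun i => (hOpen.F_regular i).lipschitz (Metric.closedBall 0 (ρ + P))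
    (isCompact_closedBall _ _) T
  choose LZ hLZ using fun i => (hOpen.Z_regular i).lipschitz (Metric.closedBall 0 (ρ + P))
    (isCompact_closedBall _ _) T
  refine ⟨∑ i, (LF i + LZ i), fun t ht e he => ?_⟩
  have hmem : ∀ ξ ∈ Metric.closedBall (0 : BlendedState m n) ρ, ∀ i,
      (ξ.1 + e i, ξ.2 i) ∈ Metric.closedBall (0 : (Fin m → ℝ) × (Fin (n i) → ℝ)) (ρ + P) := by
    intro ξ hξ i
    rw [mem_closedBall_zero_iff] at hξ ⊢
    have hP : 0 ≤ P := (norm_nonneg _).trans he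
    refine max_le ?_ ?_
    · exact (norm_add_le _ _).trans (add_le_add ((norm_fst_le ξ).trans hξ)
        ((norm_le_pi_norm e i).trans he))
    · exact ((norm_le_pi_norm ξ.2 i).trans (norm_snd_le ξ)).trans (by linarith)
  have hdist : ∀ ξ η : BlendedState m n, ∀ i, dist (ξ.1 + e i, ξ.2 i) (η.1 + e i, η.2 i)
      ≤ dist ξ η := by
    intro ξ η i
    rw [Prod.dist_eq, Prod.dist_eq, dist_add_right]
    exact max_le_max le_rfl (dist_le_pi_dist ξ.2 η.2 i)
  refine LipschitzOnWith.of_dist_le_mul fun ξ hξ η hη => ?_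
  have hF : ∀ i, ‖S.F i t (ξ.1 + e i) (ξ.2 i) - S.F i t (η.1 + e i) (η.2 i)‖
      ≤ (LF i + LZ i) * dist ξ η := fun i => by
    rw [← dist_eq_norm]
    refine ((hLF i t ht).dist_le_mul _ (hmem ξ hξ i) _ (hmem η hη i)).trans ?_
    refine (mul_le_mul_of_nonneg_left (hdist ξ η i) (LF i).2).trans ?_
    exact mul_le_mul_of_nonneg_right (le_add_of_nonneg_right (LZ i).2) dist_nonneg
  have hZ : ∀ i, dist (S.Z i t (ξ.2 i) (ξ.1 + e i)) (S.Z i t (η.2 i) (η.1 + e i))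
      ≤ (LF i + LZ i) * dist ξ η := fun i => by
    refine ((hLZ i t ht).dist_le_mul _ (hmem ξ hξ i) _ (hmem η hη i)).trans ?_
    refine (mul_le_mul_of_nonneg_left (hdist ξ η i) (LZ i).2).trans ?_
    exact mul_le_mul_of_nonneg_right (le_add_of_nonneg_left (LF i).2) dist_nonneg
  have hsum : ((∑ i, (LF i + LZ i) : NNReal) : ℝ) * dist ξ η
      = ∑ i, ((LF i : ℝ) + LZ i) * dist ξ η := by
    push_cast; rw [Finset.sum_mul]
  have hnn : ∀ i, 0 ≤ ((LF i : ℝ) + LZ i) * dist ξ η := fun i => by positivity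
  rw [hsum, Prod.dist_eq]
  refine max_le ?_ ((dist_pi_le_iff (Finset.sum_nonneg fun i _ => hnn i)).2 fun i => ?_)
  · simp only [blended]
    rw [dist_eq_norm, ← smul_sub, ← Finset.sum_sub_distrib, norm_smul]
    have h1 : ‖1 / (N : ℝ)‖ ≤ 1 := by
      rw [Real.norm_of_nonneg (by positivity), one_div]
      exact Nat.cast_inv_le_one N
    refine (mul_le_of_le_one_left (norm_nonneg _) h1).trans ?_
    exact (norm_sum_le _ _).trans (Finset.sum_le_sum fun i _ => hF i)
  · exact (hZ i).trans (Finset.single_le_sum (f := fun i => ((LF i : ℝ) + LZ i) * dist ξ η)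
      (fun i _ => hnn i) (Finset.mem_univ i))

/-- Closed loop solutions are bounded on bounded time intervals. -/
theorem exists_norm_le_of_isSolution (hOpen : S.OpenLoopAssumption t₀)
    (hGain : S.GainAssumption t₀) (hGraph : S.G.Connected) (hDesign : S.DesignAssumption t₀)
    (hglobal : ∀ t₁, t₀ ≤ t₁ → ∀ (ξ : BlendedState m n) (e : ℝ → Fin N → Fin m → ℝ),
      IsLocEssBounded t₁ e →
      ∃ x : ℝ → BlendedState m n, x t₁ = ξ ∧
        IsSolution Set.univ (fun t ξ => S.blended t ξ (e t)) t₁ ⊤ x)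
    {t₁ b : ℝ} (ht₁ : t₀ ≤ t₁) {x : ℝ → NetworkState m n}
    (hx : IsSolution S.funnel S.closedLoop t₁ b x) :
    ∃ R, ∀ t ∈ Set.Ico t₁ b, ‖x t‖ ≤ R := by
  obtain ⟨P, hP0, hP⟩ := exists_syncBound_le hDesign
  -- The deviation is extended by zero past `b`. The possible jump at `b` is harmless, since ISS
  -- inputs need only be measurable and locally essentially bounded.
  let e : ℝ → Fin N → Fin m → ℝ := (Set.Ico t₁ b).indicator fun t => deviation (x t)
  have he : ∀ t ∈ Set.Ico t₁ b, e t = deviation (x t) := fun t ht => Set.indicator_of_mem ht _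
  have hdev : ∀ t ∈ Set.Ico t₁ b, ‖deviation (x t)‖ ≤ P := fun t ht =>
    (norm_deviation_le' hGraph hDesign (ht₁.trans ht.1)
      (hx.mem_domain t (mem_timeInterval_coe.2 ht))).trans (hP t (ht₁.trans ht.1))
  have heP : ∀ t, ‖e t‖ ≤ P := by
    intro t
    by_cases ht : t ∈ Set.Ico t₁ b
    · rw [he t ht]; exact hdev t ht
    · simpa [e, Set.indicator_of_notMem ht] using hP0
  have hxc : ContinuousOn x (Set.Ico t₁ b) := by
    intro t ht
    obtain ⟨u, hu⟩ := exists_between ht.2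
    refine ((hx.continuousOn_Icc (T := u) (mem_timeInterval_coe.2
      ⟨ht.1.trans hu.1.le, hu.2⟩)) t ⟨ht.1, hu.1.le⟩).mono_of_mem_nhdsWithin ?_
    filter_upwards [self_mem_nhdsWithin, mem_nhdsWithin_of_mem_nhds (gt_mem_nhds hu.1)] with s hs hs'
    exact ⟨hs.1, le_of_lt hs'⟩
  have hem : AEStronglyMeasurable e volume :=
    (aestronglyMeasurable_indicator_iff measurableSet_Ico).2
      ((continuous_deviation.comp_continuousOn hxc).aestronglyMeasurable measurableSet_Ico)
  obtain ⟨η, hη₁, hη⟩ := hglobal t₁ ht₁ (average m n (x t₁)) e fun T =>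
    memLp_top_of_bound hem.restrict P (ae_of_all _ heP)
  have hav := isSolution_average hGain hDesign ht₁ hx (e := e) fun t ht =>
    he t (mem_timeInterval_coe.1 ht)
  have hηc : ∀ T, t₁ ≤ T → ContinuousOn η (Set.Icc t₁ T) := fun T hT =>
    hη.continuousOn_Icc (mem_timeInterval_top.2 hT)
  have hlt : t₁ < b := EReal.coe_lt_coe_iff.1 hx.lt
  have heq : ∀ T ∈ Set.Ico t₁ b, average m n (x T) = η T := by
    intro T hT
    have hT' := mem_timeInterval_coe.2 hT
    obtain ⟨ρ₁, hρ₁⟩ := (isCompact_Icc.image_of_continuousOn (hav.continuousOn_Icc hT')).isBounded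
      |>.exists_norm_le
    obtain ⟨ρ₂, hρ₂⟩ := (isCompact_Icc.image_of_continuousOn (hηc T hT.1)).isBounded
      |>.exists_norm_le
    obtain ⟨L, hL⟩ := exists_lipschitzOnWith_blended hOpen (max ρ₁ ρ₂) P T
    refine eqOn_of_lipschitzOnWith (f := fun t ξ => S.blended t ξ (e t))
      (K := Metric.closedBall 0 (max ρ₁ ρ₂)) (L := L) (x₀ := average m n (x t₁))
      (fun t ht => hL t ⟨ht₁.trans ht.1, ht.2⟩ (e t) (heP t))
      (hav.continuousOn_Icc hT') (hηc T hT.1) (fun t ht => ?_) (fun t ht => ?_)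
      (fun t ht => hav.integrable t (mem_timeInterval_of_le hT' ht.1 ht.2))
      (fun t ht => hη.integrable t (mem_timeInterval_top.2 ht.1))
      (fun t ht => hav.eq_integral t (mem_timeInterval_of_le hT' ht.1 ht.2))
      (fun t ht => hη₁ ▸ hη.eq_integral t (mem_timeInterval_top.2 ht.1)) ⟨hT.1, le_rfl⟩
    · exact mem_closedBall_zero_iff.2 ((hρ₁ _ ⟨t, ht, rfl⟩).trans (le_max_left _ _))
    · exact mem_closedBall_zero_iff.2 ((hρ₂ _ ⟨t, ht, rfl⟩).trans (le_max_right _ _))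
  -- The comparison solution is continuous up to and including `b`, so it bounds the mean uniformly
  -- on `[t₁, b)`.
  obtain ⟨ρ, hρ⟩ := (isCompact_Icc.image_of_continuousOn (hηc b hlt.le)).isBounded.exists_norm_le
  refine ⟨ρ + P, fun t ht => ?_⟩
  have hηρ : ‖average m n (x t)‖ ≤ ρ := by
    rw [heq t ht]; exact hρ _ ⟨t, ⟨ht.1, ht.2.le⟩, rfl⟩
  have hρ0 : 0 ≤ ρ := (norm_nonneg _).trans hηρ
  refine max_le ((pi_norm_le_iff_of_nonneg (by positivity)).2 fun i => ?_) ?_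
  · have : (x t).1 i = (average m n (x t)).1 + deviation (x t) i := by simp [deviation]
    rw [this]
    exact (norm_add_le _ _).trans (add_le_add ((norm_fst_le _).trans hηρ)
      ((norm_le_pi_norm _ i).trans (hdev t ht)))
  · have h2 : (x t).2 = (average m n (x t)).2 := by rw [average_apply]
    rw [h2]
    exact ((norm_snd_le _).trans hηρ).trans (le_add_of_nonneg_right hP0)

end MultiAgentSystem

/-! ### Continuation of solutions -/

section Continuation

variable {X : Type*} [NormedAddCommGroup X] [NormedSpace ℝ X] {Ω : Set (ℝ × X)} {f : ℝ → X → X}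
  {t₁ : ℝ} {x : ℝ → X}

/-- A solution on `[t₁, b)` with integrable derivative continues with a solution that starts at its
limit. -/
theorem IsSolution.exists_concat {b c : ℝ} (hx : IsSolution Ω f t₁ b x)
    (hi : IntervalIntegrable (fun s => f s (x s)) volume t₁ b) (hbc : b < c) {ξ : ℝ → X}
    (hΩ : ∀ t ∈ Set.Icc b c, (t, ξ t) ∈ Ω)
    (hξi : IntervalIntegrable (fun s => f s (ξ s)) volume b c)
    (hξ : ∀ t ∈ Set.Icc b c, ξ t = (x t₁ + ∫ s in t₁..b, f s (x s)) + ∫ s in b..t, f s (ξ s)) :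
    ∃ x₂, IsSolution Ω f t₁ c x₂ ∧ Set.EqOn x₂ x (timeInterval t₁ b) := by
  have htb : t₁ < b := EReal.coe_lt_coe_iff.1 hx.lt
  -- The switch is at `t < b` because the value of `x` at `b` is arbitrary; the integrals do not see
  -- this point.
  let x₂ : ℝ → X := fun t => if t < b then x t else ξ t
  have hlt : ∀ t, t < b → x₂ t = x t := fun t ht => if_pos ht
  have hge : ∀ t, b ≤ t → x₂ t = ξ t := fun t ht => if_neg ht.not_gt
  have hae : ∀ t ≤ b, ∀ᵐ s, s ∈ Set.uIoc t₁ t → t₁ ≤ t → f s (x s) = f s (x₂ s) := by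
    intro t ht
    filter_upwards [Measure.ae_ne volume b] with s hs hmem h₁
    rw [Set.uIoc_of_le h₁] at hmem
    rw [hlt s (lt_of_le_of_ne (hmem.2.trans ht) hs)]
  have hint₁ : ∀ t, t₁ ≤ t → t ≤ b →
      IntervalIntegrable (fun s => f s (x₂ s)) volume t₁ t := by
    intro t h₁ h₂
    refine (hi.mono_set ?_).congr_ae ?_
    · rw [Set.uIcc_of_le h₁, Set.uIcc_of_le htb.le]; exact Set.Icc_subset_Icc_right h₂
    · refine (ae_restrict_iff' measurableSet_uIoc).2 ?_
      filter_upwards [hae t h₂] with s hs hmem using hs hmem h₁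
  have heq₁ : ∀ t, t₁ ≤ t → t ≤ b →
      ∫ s in t₁..t, f s (x₂ s) = ∫ s in t₁..t, f s (x s) := by
    intro t h₁ h₂
    refine (intervalIntegral.integral_congr_ae ?_).symm
    filter_upwards [hae t h₂] with s hs hmem using hs hmem h₁
  have hint₂ : ∀ t ∈ Set.Icc b c, IntervalIntegrable (fun s => f s (x₂ s)) volume b t := by
    intro t ht
    refine (hξi.mono_set ?_).congr fun s hs => ?_
    · rw [Set.uIcc_of_le ht.1, Set.uIcc_of_le hbc.le]; exact Set.Icc_subset_Icc_right ht.2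
    · rw [Set.uIoc_of_le ht.1] at hs
      simp only [hge s hs.1.le]
  have heq₂ : ∀ t ∈ Set.Icc b c, ∫ s in b..t, f s (x₂ s) = ∫ s in b..t, f s (ξ s) := by
    intro t ht
    refine intervalIntegral.integral_congr fun s hs => ?_
    rw [Set.uIcc_of_le ht.1] at hs
    simp only [hge s hs.1]
  have hx₁ : x₂ t₁ = x t₁ := hlt _ htb
  refine ⟨x₂, ⟨EReal.coe_lt_coe_iff.2 (htb.trans hbc), ?_, ?_, ?_⟩, ?_⟩
  · intro t ht
    rw [mem_timeInterval_coe] at ht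
    rcases lt_or_ge t b with h | h
    · rw [hlt t h]; exact hx.mem_domain t (mem_timeInterval_coe.2 ⟨ht.1, h⟩)
    · rw [hge t h]; exact hΩ t ⟨h, ht.2.le⟩
  · intro t ht
    rw [mem_timeInterval_coe] at ht
    rcases lt_or_ge t b with h | h
    · exact hint₁ t ht.1 h.le
    · exact (hint₁ b htb.le le_rfl).trans (hint₂ t ⟨h, ht.2.le⟩)
  · intro t ht
    rw [mem_timeInterval_coe] at ht
    rcases lt_or_ge t b with h | h
    · rw [hx₁, hlt t h, heq₁ t ht.1 h.le]
      exact hx.eq_integral t (mem_timeInterval_coe.2 ⟨ht.1, h⟩)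
    · have hm : t ∈ Set.Icc b c := ⟨h, ht.2.le⟩
      rw [hx₁, hge t h, ← intervalIntegral.integral_add_adjacent_intervals (hint₁ b htb.le le_rfl)
        (hint₂ t hm), heq₁ b htb.le le_rfl, heq₂ t hm, ← add_assoc]
      exact hξ t hm
  · intro t ht
    exact hlt t (mem_timeInterval_coe.1 ht).2

end Continuation

/-! ### Unsaturated limits of gradient-like networks -/

/-- Integrating the velocity bound over the remaining time `[t, b]` limits how far above its final
value `y` can be. -/
theorem sub_le_of_eventually_ge {y g : ℝ → ℝ} {a b l C : ℝ} (hab : a < b)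
    (hg : IntervalIntegrable g volume a b)
    (hy : ∀ t ∈ Set.Ico a b, y t = l - ∫ s in t..b, g s)
    (h : ∀ᶠ t in 𝓝[<] b, -C ≤ g t) : ∀ᶠ t in 𝓝[<] b, y t - l ≤ C * (b - t) := by
  obtain ⟨u, hu, hC⟩ := (mem_nhdsLT_iff_exists_Ioo_subset).1 h
  filter_upwards [Ioo_mem_nhdsLT (max_lt hu hab)] with t ht
  have hat : a ≤ t := (le_max_right _ _).trans ht.1.le
  have hti : IntervalIntegrable g volume t b := hg.mono_set (by
    rw [Set.uIcc_of_le ht.2.le, Set.uIcc_of_le hab.le]; exact Set.Icc_subset_Icc_left hat)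
  have hle : (∫ _ in t..b, -C) ≤ ∫ s in t..b, g s := by
    refine intervalIntegral.integral_mono_on_of_le_Ioo ht.2.le intervalIntegrable_const hti
      fun s hs => hC ⟨((le_max_left _ _).trans_lt ht.1).trans hs.1, hs.2⟩
  rw [intervalIntegral.integral_const, smul_eq_mul] at hle
  rw [hy t ⟨hat, ht.2⟩]
  linarith

/-- In a network whose node velocities are bounded below unless a link to a lower node saturates,
and tend to `-∞` at nodes with saturated links to lower nodes only, no link saturates. -/
theorem not_saturated {V : Type*} [Finite V] {y g : V → ℝ → ℝ} {l : V → ℝ} {sat : V → V → Prop}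
    {a b : ℝ} (hab : a < b) (hg : ∀ k, IntervalIntegrable (g k) volume a b)
    (hy : ∀ k, ∀ t ∈ Set.Ico a b, y k t = l k - ∫ s in t..b, g k s)
    (hsat : ∀ k j, sat k j → l j < l k)
    (hlower : ∀ k, (∀ j, ¬ sat k j) → ∃ C, ∀ᶠ t in 𝓝[<] b, -C ≤ g k t)
    (hstep : ∀ k j, sat k j → ∃ D, ∀ᶠ t in 𝓝[<] b, y k t - y j t ≤ l k - l j + D * (b - t))
    (hblow : ∀ k j, sat k j → (∀ i, ¬ sat i k) → Tendsto (g k) (𝓝[<] b) atBot) (k j : V) :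
    ¬ sat k j := by
  -- Among the nodes violating the linear bound take one with lowest limit. A lower saturated
  -- neighbour satisfies the bound and `hstep` transfers it upwards; without such a neighbour
  -- `hlower` gives it directly.
  have hbound : ∀ k, ∃ C, ∀ᶠ t in 𝓝[<] b, y k t - l k ≤ C * (b - t) := by
    by_contra hcon
    push Not at hcon
    obtain ⟨k, hk, hmin⟩ := Set.exists_min_image
      {k | ∀ C, ¬ ∀ᶠ t in 𝓝[<] b, y k t - l k ≤ C * (b - t)} l (Set.toFinite _)
      (by obtain ⟨k, hk⟩ := hcon; exact ⟨k, fun C h => (hk C) (h.mono fun t ht => by simpa using ht)⟩)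
    by_cases h : ∃ j, sat k j
    · obtain ⟨j, hj⟩ := h
      have hjn : ¬ ∀ C, ¬ ∀ᶠ t in 𝓝[<] b, y j t - l j ≤ C * (b - t) := fun hbad =>
        (hmin j hbad).not_gt (hsat k j hj)
      push Not at hjn
      obtain ⟨C, hC⟩ := hjn
      obtain ⟨D, hD⟩ := hstep k j hj
      refine hk (C + D) ?_
      filter_upwards [hC, hD] with t h₁ h₂
      linarith
    · push Not at h
      obtain ⟨C, hC⟩ := hlower k h
      exact hk C (sub_le_of_eventually_ge hab (hg k) (hy k) hC)
  intro hkj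
  -- The highest node with a lower saturated neighbour has no upper one, so its velocity tends to
  -- `-∞`. It then exceeds its limit by at least `(C + 1) * (b - t)`, contradicting the bound with
  -- `C`.
  obtain ⟨k, ⟨j, hj⟩, hmax⟩ := Set.exists_max_image {k | ∃ j, sat k j} l (Set.toFinite _) ⟨k, j, hkj⟩
  have hup : ∀ i, ¬ sat i k := fun i hi => (hmax i ⟨k, hi⟩).not_gt (hsat i k hi)
  obtain ⟨C, hC⟩ := hbound k
  have hneg : ∀ᶠ t in 𝓝[<] b, (fun t => - y k t) t - (-l k) ≤ (-(C + 1)) * (b - t) := by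
    refine sub_le_of_eventually_ge (g := fun t => - g k t) hab (hg k).neg (fun t ht => ?_) ?_
    · simp only [intervalIntegral.integral_neg, hy k t ht]; ring
    · filter_upwards [(hblow k j hj hup).eventually_le_atBot (-(C + 1))] with t ht
      linarith
  obtain ⟨t, h₁, h₂, ht⟩ := (hC.and (hneg.and self_mem_nhdsWithin)).exists
  have : t < b := ht
  nlinarith

/-! ### Dissipation by the coupling and integrability of the velocity -/

/-- A continuous function on `(-1, 1)` with poles `±∞` at `±1` is dissipative. -/
theorem exists_half_abs_sub_le_mul {f : ℝ → ℝ} (hc : ContinuousOn f (Set.Ioo (-1) 1))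
    (hr : Tendsto f (𝓝[<] 1) atTop) (hl : Tendsto f (𝓝[>] (-1)) atBot) :
    ∃ C, 0 ≤ C ∧ ∀ r ∈ Set.Ioo (-1 : ℝ) 1, |f r| / 2 - C ≤ r * f r := by
  obtain ⟨u, hu, hu'⟩ := mem_nhdsLT_iff_exists_Ioo_subset.1 (hr.eventually_ge_atTop 0)
  obtain ⟨v, hv, hv'⟩ := mem_nhdsGT_iff_exists_Ioo_subset.1 (hl.eventually_le_atBot 0)
  have hu1 : u < 1 := hu
  have hv1 : -1 < v := hv
  obtain ⟨C, hC⟩ := (isCompact_Icc.image_of_continuousOn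
    (hc.mono (Set.Icc_subset_Ioo (lt_min hv1 (by norm_num : (-1 : ℝ) < -(1 / 2)))
      (max_lt hu1 (by norm_num : (1 / 2 : ℝ) < 1))))).isBounded.exists_norm_le
  -- Near `±1` the function has the sign of `r` and `|r| > 1/2`. On the remaining compact interval
  -- `|f r| ≤ |C|`, and `3/2 * |C| ≤ 2 * |C|` suffices.
  refine ⟨2 * |C|, by positivity, fun r hr => ?_⟩
  rcases lt_or_ge (max u (1 / 2)) r with h | h
  · have h0 : 0 ≤ f r := hu' ⟨(le_max_left _ _).trans_lt h, hr.2⟩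
    have h2 : 1 / 2 < r := (le_max_right _ _).trans_lt h
    rw [abs_of_nonneg h0]
    nlinarith [abs_nonneg C]
  · rcases lt_or_ge r (min v (-(1 / 2))) with h' | h'
    · have h0 : f r ≤ 0 := hv' ⟨hr.1, h'.trans_le (min_le_left _ _)⟩
      have h2 : r < -(1 / 2) := h'.trans_le (min_le_right _ _)
      rw [abs_of_nonpos h0]
      nlinarith [abs_nonneg C]
    · have hCr : |f r| ≤ |C| := (hC _ ⟨r, ⟨h', h⟩, rfl⟩).trans (le_abs_self C)
      have h1 : |r * f r| ≤ |f r| := by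
        rw [abs_mul]
        exact mul_le_of_le_one_left (abs_nonneg _) (abs_le.2 ⟨hr.1.le, hr.2.le⟩)
      have := (abs_le.1 h1).1
      linarith [abs_nonneg C]

namespace MultiAgentSystem

variable {N m : ℕ} {n q : Fin N → ℕ} {S : MultiAgentSystem N m n q} {t₀ : ℝ}

theorem continuousOn_psi (hDesign : S.DesignAssumption t₀) {i j : Fin N} (h : S.G.Adj i j)
    (p : Fin m) : ContinuousOn (S.ψ i j p) (Set.Ici t₀) :=
  (hDesign.ψ_contDiffOn i j p h).continuousOn

/-- The funnel boundary moves at bounded speed, which lets the linear bound near `b` pass across a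
saturated edge. -/
theorem exists_abs_psi_sub_le (hDesign : S.DesignAssumption t₀) {i j : Fin N} (h : S.G.Adj i j)
    (p : Fin m) : ∃ D, ∀ s t, t₀ ≤ s → t₀ ≤ t → |S.ψ i j p t - S.ψ i j p s| ≤ D * |t - s| := by
  obtain ⟨D, hD⟩ := hDesign.ψ_deriv_bounded i j p h
  refine ⟨D, fun s t hs ht => ?_⟩
  exact (convex_Ici t₀).norm_image_sub_le_of_norm_derivWithin_le
    ((hDesign.ψ_contDiffOn i j p h).differentiableOn one_ne_zero) (fun u hu => hD u hu) hs ht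

/-- The vector fields are bounded on bounded sets. -/
theorem exists_open_loop_bound (hOpen : S.OpenLoopAssumption t₀) (R : ℝ) :
    ∃ K, 0 ≤ K ∧ ∀ t, t₀ ≤ t → ∀ x : NetworkState m n, ‖x‖ ≤ R → ∀ i,
      ‖S.F i t (x.1 i) (x.2 i)‖ ≤ K ∧ ‖S.Z i t (x.2 i) (x.1 i)‖ ≤ K := by
  choose KF hKF using fun i => (hOpen.F_regular i).bounded (Metric.closedBall 0 R)
    (isCompact_closedBall _ _)
  choose KZ hKZ using fun i => (hOpen.Z_regular i).bounded (Metric.closedBall 0 R)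
    (isCompact_closedBall _ _)
  have hmem : ∀ x : NetworkState m n, ‖x‖ ≤ R → ∀ i,
      (x.1 i, x.2 i) ∈ Metric.closedBall (0 : (Fin m → ℝ) × (Fin (n i) → ℝ)) R := by
    intro x hx i
    rw [mem_closedBall_zero_iff]
    exact max_le (((norm_le_pi_norm x.1 i).trans (norm_fst_le x)).trans hx)
      (((norm_le_pi_norm x.2 i).trans (norm_snd_le x)).trans hx)
  have hsum : ∀ i, |KF i| + |KZ i| ≤ ∑ i, (|KF i| + |KZ i|) := fun i =>
    Finset.single_le_sum (f := fun i => |KF i| + |KZ i|) (fun i _ => by positivity)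
      (Finset.mem_univ i)
  refine ⟨∑ i, (|KF i| + |KZ i|), Finset.sum_nonneg fun i _ => by positivity,
    fun t ht x hx i => ⟨?_, ?_⟩⟩
  · have := hKF i t ht _ (hmem x hx i)
    linarith [hsum i, le_abs_self (KF i), abs_nonneg (KZ i)]
  · have := hKZ i t ht _ (hmem x hx i)
    linarith [hsum i, le_abs_self (KZ i), abs_nonneg (KF i)]

/-- With `ν = ψ r` the product is `ψ * (r * μ r)`. The minimum of `ψ` on the compact time interval
provides `c`, its upper bound provides `C`, and finiteness makes both uniform over edges and
components. -/
theorem exists_edge_dissipation (hDesign : S.DesignAssumption t₀) {t₁ : ℝ} (ht₁ : t₀ ≤ t₁)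
    (b : ℝ) : ∃ c C, 0 < c ∧ 0 ≤ C ∧ ∀ t ∈ Set.Icc t₁ b, ∀ x : NetworkState m n,
      (t, x) ∈ S.funnel → ∀ i j p,
        c * |S.edgeForce t x p i j| - C ≤ (x.1 j p - x.1 i p) * S.edgeForce t x p i j := by
  have hedge : ∀ a : Fin N × Fin N × Fin m, ∃ c C, 0 < c ∧ 0 ≤ C ∧ ∀ t ∈ Set.Icc t₁ b,
      ∀ x : NetworkState m n, (t, x) ∈ S.funnel →
        c * |S.edgeForce t x a.2.2 a.1 a.2.1| - C ≤
          (x.1 a.2.1 a.2.2 - x.1 a.1 a.2.2) * S.edgeForce t x a.2.2 a.1 a.2.1 := by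
    rintro ⟨i, j, p⟩
    by_cases h : S.G.Adj i j
    swap
    · exact ⟨1, 0, one_pos, le_rfl, fun t _ x _ => by simp [edgeForce_of_not_adj h]⟩
    rcases lt_or_ge b t₁ with hb | hb
    · exact ⟨1, 0, one_pos, le_rfl, fun t ht => absurd (ht.1.trans ht.2) hb.not_ge⟩
    obtain ⟨C, hC0, hC⟩ := exists_half_abs_sub_le_mul (hDesign.μ_continuousOn i j p h)
      (hDesign.μ_tendsto_right i j p h) (hDesign.μ_tendsto_left i j p h)
    obtain ⟨P, hP⟩ := hDesign.ψ_bounded i j p h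
    obtain ⟨s, hs, hmin⟩ := isCompact_Icc.exists_isMinOn (Set.nonempty_Icc.2 hb)
      ((continuousOn_psi hDesign h p).mono fun t ht => ht₁.trans ht.1)
    have hψs := hDesign.ψ_pos i j p h s (ht₁.trans hs.1)
    have hP0 : 0 ≤ P := (hDesign.ψ_pos i j p h t₁ ht₁).le.trans (hP t₁ ht₁)
    refine ⟨S.ψ i j p s / 2, P * C, by positivity, by positivity, fun t ht x hx => ?_⟩
    have ht' := ht₁.trans ht.1
    have hψ := hDesign.ψ_pos i j p h t ht'
    have hmn : S.ψ i j p s ≤ S.ψ i j p t := hmin ht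
    have hr := hC _ (div_mem_Ioo_of_mem_funnel hDesign ht' hx h p)
    simp only [edgeForce_of_adj h]
    set r := (x.1 j p - x.1 i p) / S.ψ i j p t with hrdef
    have hν : x.1 j p - x.1 i p = S.ψ i j p t * r := by rw [hrdef]; field_simp
    rw [hν]
    have h1 := mul_le_mul_of_nonneg_left hr hψ.le
    have h2 := mul_le_mul_of_nonneg_right hmn (abs_nonneg (S.μ i j p r))
    have h3 := mul_le_mul_of_nonneg_right (hP t ht') hC0
    nlinarith
  choose c C hc hC h using hedge
  obtain ⟨c₀, hc₀, hcpos⟩ : ∃ c₀, (∀ a, c₀ ≤ c a) ∧ 0 < c₀ :=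
    ((eventually_all.2 fun a => mem_nhdsWithin_of_mem_nhds (Iic_mem_nhds (hc a))).and
      (self_mem_nhdsWithin (a := (0 : ℝ)) (s := Set.Ioi 0))).exists
  refine ⟨c₀, ∑ a, C a, hcpos, Finset.sum_nonneg fun a _ => hC a, fun t ht x hx i j p => ?_⟩
  have h1 := h (i, j, p) t ht x hx
  have h2 : C (i, j, p) ≤ ∑ a, C a :=
    Finset.single_le_sum (f := C) (fun a _ => hC a) (Finset.mem_univ _)
  have h3 := mul_le_mul_of_nonneg_right (hc₀ (i, j, p)) (abs_nonneg (S.edgeForce t x p i j))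
  simp only at h1
  linarith

/-- The energy pairing controls the norm of the right-hand side of the closed loop. -/
theorem exists_norm_closedLoop_le (hOpen : S.OpenLoopAssumption t₀) (hGain : S.GainAssumption t₀)
    (hDesign : S.DesignAssumption t₀) {t₁ : ℝ} (ht₁ : t₀ ≤ t₁) (b R : ℝ) (hR : 0 ≤ R) :
    ∃ A B, 0 ≤ A ∧ 0 ≤ B ∧ ∀ t ∈ Set.Icc t₁ b, ∀ x : NetworkState m n, (t, x) ∈ S.funnel →
      ‖x‖ ≤ R → ‖S.closedLoop t x‖ ≤
        A - B * ∑ p, ∑ i, x.1 i p * (S.closedLoop t x).1 i p := by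
  obtain ⟨K, hK0, hK⟩ := exists_open_loop_bound hOpen R
  obtain ⟨c, C, hc, hC0, hC⟩ := exists_edge_dissipation hDesign ht₁ b
  have hcomp : ∀ t ∈ Set.Icc t₁ b, ∀ x : NetworkState m n, (t, x) ∈ S.funnel → ‖x‖ ≤ R → ∀ p,
      c * ∑ i, |(S.closedLoop t x).1 i p| ≤ (c * (N * K) + 2 * (N * (R * K)) + N * (N * C)) -
        2 * ∑ i, x.1 i p * (S.closedLoop t x).1 i p := by
    intro t ht x hx hxR p
    have ht' := ht₁.trans ht.1
    have hF : ∀ i, |S.F i t (x.1 i) (x.2 i) p| ≤ K := fun i =>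
      (norm_le_pi_norm (S.F i t (x.1 i) (x.2 i)) p).trans (hK t ht' x hxR i).1
    have hxi : ∀ i, |x.1 i p| ≤ R := fun i =>
      (norm_le_pi_norm (x.1 i) p).trans (((norm_le_pi_norm x.1 i).trans (norm_fst_le x)).trans hxR)
    simp only [closedLoop_fst_apply hGain ht']
    have h1 : ∑ i, |S.F i t (x.1 i) (x.2 i) p + ∑ j, S.edgeForce t x p i j| ≤
        N * K + ∑ i, ∑ j, |S.edgeForce t x p i j| := by
      have : (N : ℝ) * K = ∑ _i : Fin N, K := by simp
      rw [this, ← Finset.sum_add_distrib]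
      exact Finset.sum_le_sum fun i _ => (abs_add_le _ _).trans
        (add_le_add (hF i) (Finset.abs_sum_le_sum_abs _ _))
    have h2 : ∑ i, x.1 i p * S.F i t (x.1 i) (x.2 i) p ≤ N * (R * K) := by
      have : (N : ℝ) * (R * K) = ∑ _i : Fin N, R * K := by simp
      rw [this]
      refine Finset.sum_le_sum fun i _ => (le_abs_self _).trans ?_
      rw [abs_mul]
      exact mul_le_mul (hxi i) (hF i) (abs_nonneg _) hR
    -- Symmetrisation: swapping `i` and `j` turns the power of the coupling into minus half the sum
    -- of relative displacement times force.
    have h3 : 2 * ∑ i, ∑ j, x.1 i p * S.edgeForce t x p i j =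
        - ∑ i, ∑ j, (x.1 j p - x.1 i p) * S.edgeForce t x p i j := by
      have hswap : ∑ i, ∑ j, x.1 j p * S.edgeForce t x p i j =
          - ∑ i, ∑ j, x.1 i p * S.edgeForce t x p i j := by
        rw [Finset.sum_comm, ← Finset.sum_neg_distrib]
        refine Finset.sum_congr rfl fun i _ => ?_
        rw [← Finset.sum_neg_distrib]
        refine Finset.sum_congr rfl fun j _ => ?_
        rw [edgeForce_antisymm hDesign ht' hx p j i, mul_neg]
      simp only [sub_mul, Finset.sum_sub_distrib, hswap]
      ring
    have h4 : c * ∑ i, ∑ j, |S.edgeForce t x p i j| - N * (N * C) ≤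
        ∑ i, ∑ j, (x.1 j p - x.1 i p) * S.edgeForce t x p i j := by
      have : (N : ℝ) * (N * C) = ∑ _i : Fin N, ∑ _j : Fin N, C := by simp
      rw [this, Finset.mul_sum, ← Finset.sum_sub_distrib]
      refine Finset.sum_le_sum fun i _ => ?_
      rw [Finset.mul_sum, ← Finset.sum_sub_distrib]
      exact Finset.sum_le_sum fun j _ => hC t ht x hx i j p
    have h5 : ∑ i, x.1 i p * (S.F i t (x.1 i) (x.2 i) p + ∑ j, S.edgeForce t x p i j) =
        ∑ i, x.1 i p * S.F i t (x.1 i) (x.2 i) p + ∑ i, ∑ j, x.1 i p * S.edgeForce t x p i j := by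
      simp only [mul_add, Finset.sum_add_distrib, Finset.mul_sum]
    rw [h5]
    have h6 := mul_le_mul_of_nonneg_left h1 hc.le
    linarith
  set D := c * (N * K) + 2 * (N * (R * K)) + N * (N * C) with hD
  have hD0 : 0 ≤ D := by positivity
  refine ⟨K + m * D / c, 2 / c, by positivity, by positivity, fun t ht x hx hxR => ?_⟩
  have hsum : ∑ p, ∑ i, |(S.closedLoop t x).1 i p| ≤
      m * D / c - 2 / c * ∑ p, ∑ i, x.1 i p * (S.closedLoop t x).1 i p := by
    have h1 := Finset.sum_le_sum fun p (_ : p ∈ Finset.univ) => hcomp t ht x hx hxR p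
    rw [Finset.sum_sub_distrib, ← Finset.mul_sum, ← Finset.mul_sum] at h1
    simp only [Finset.sum_const, Finset.card_univ, Fintype.card_fin, nsmul_eq_mul] at h1
    rw [div_mul_eq_mul_div, ← sub_div, le_div_iff₀ hc]
    linarith
  have hnn : 0 ≤ ∑ p, ∑ i, |(S.closedLoop t x).1 i p| :=
    Finset.sum_nonneg fun p _ => Finset.sum_nonneg fun i _ => abs_nonneg _
  have hle : ‖S.closedLoop t x‖ ≤ K + ∑ p, ∑ i, |(S.closedLoop t x).1 i p| := by
    refine max_le ?_ ?_
    · refine (pi_norm_le_iff_of_nonneg (by positivity)).2 fun i =>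
        (pi_norm_le_iff_of_nonneg (by positivity)).2 fun p => ?_
      have h1 : |(S.closedLoop t x).1 i p| ≤ ∑ i, |(S.closedLoop t x).1 i p| :=
        Finset.single_le_sum (f := fun i => |(S.closedLoop t x).1 i p|)
          (fun i _ => abs_nonneg _) (Finset.mem_univ i)
      have h2 : ∑ i, |(S.closedLoop t x).1 i p| ≤ ∑ p, ∑ i, |(S.closedLoop t x).1 i p| :=
        Finset.single_le_sum (f := fun p => ∑ i, |(S.closedLoop t x).1 i p|)
          (fun p _ => Finset.sum_nonneg fun i _ => abs_nonneg _) (Finset.mem_univ p)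
      rw [Real.norm_eq_abs]
      linarith
    · refine (pi_norm_le_iff_of_nonneg (by positivity)).2 fun i => ?_
      exact ((hK t (ht₁.trans ht.1) x hxR i).2).trans (le_add_of_nonneg_right hnn)
  linarith

end MultiAgentSystem

theorem IsSolution.apply_eq_add_integral {X : Type*} [NormedAddCommGroup X] [NormedSpace ℝ X]
    [CompleteSpace X] {Ω : Set (ℝ × X)} {f : ℝ → X → X} {t₁ : ℝ} {ω : EReal} {x : ℝ → X}
    (hx : IsSolution Ω f t₁ ω x) (P : X →L[ℝ] ℝ) {t : ℝ} (ht : t ∈ timeInterval t₁ ω) :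
    P (x t) = P (x t₁) + ∫ s in t₁..t, P (f s (x s)) := by
  conv_lhs => rw [hx.eq_integral t ht, map_add, ← P.intervalIntegral_comp_comm (hx.integrable t ht)]

namespace MultiAgentSystem

variable {N m : ℕ} {n q : Fin N → ℕ} {S : MultiAgentSystem N m n q} {t₀ : ℝ}

/-- The output component `p` of agent `i`. -/
noncomputable def outputComponent (m : ℕ) (n : Fin N → ℕ) (i : Fin N) (p : Fin m) :
    NetworkState m n →L[ℝ] ℝ :=
  ContinuousLinearMap.proj p ∘L ContinuousLinearMap.proj i ∘L ContinuousLinearMap.fst ℝ _ _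

/-- A bounded closed loop solution on a bounded interval has an integrable derivative. -/
theorem intervalIntegrable_closedLoop (hOpen : S.OpenLoopAssumption t₀)
    (hGain : S.GainAssumption t₀) (hDesign : S.DesignAssumption t₀) {t₁ b R : ℝ}
    (ht₁ : t₀ ≤ t₁) {x : ℝ → NetworkState m n} (hx : IsSolution S.funnel S.closedLoop t₁ b x)
    (hR : ∀ t ∈ Set.Ico t₁ b, ‖x t‖ ≤ R) :
    IntervalIntegrable (fun s => S.closedLoop s (x s)) volume t₁ b := by
  have htb : t₁ < b := EReal.coe_lt_coe_iff.1 hx.lt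
  have hR0 : 0 ≤ R := (norm_nonneg _).trans (hR t₁ ⟨le_rfl, htb⟩)
  obtain ⟨A, B, hA, hB, hAB⟩ := exists_norm_closedLoop_le hOpen hGain hDesign ht₁ b R hR0
  rw [intervalIntegrable_iff_integrableOn_Ioc_of_le htb.le]
  obtain ⟨T, -, hT, hTlim⟩ := exists_seq_strictMono_tendsto' htb
  have hTm : ∀ k, T k ∈ timeInterval t₁ (b : EReal) := fun k =>
    mem_timeInterval_coe.2 ⟨(hT k).1.le, (hT k).2⟩
  refine integrableOn_Ioc_of_intervalIntegral_norm_bounded_right (l := atTop) (b := T)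
    -- Each of the `m * N` energies is at most `R ^ 2 / 2` initially and never negative, so the
    -- bound does not depend on `k`.
    (I := A * (b - t₁) + B * (m * (N * (R ^ 2 / 2)))) (fun k => ?_) hTlim
    (Eventually.of_forall fun k => ?_)
  · exact (intervalIntegrable_iff_integrableOn_Ioc_of_le (hT k).1.le).1 (hx.integrable _ (hTm k))
  · have hTk := hT k
    have hmem : ∀ s ∈ Set.Icc t₁ (T k), s ∈ Set.Ico t₁ b := fun s hs => ⟨hs.1, hs.2.trans_lt hTk.2⟩
    have hgi : ∀ i p, IntervalIntegrable (fun s => (S.closedLoop s (x s)).1 i p) volume t₁ (T k) :=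
      fun i p => ⟨(outputComponent m n i p).integrable_comp (hx.integrable _ (hTm k)).1,
        (outputComponent m n i p).integrable_comp (hx.integrable _ (hTm k)).2⟩
    have hyc : ∀ i p, ContinuousOn (fun s => (x s).1 i p) (Set.uIcc t₁ (T k)) := fun i p => by
      rw [Set.uIcc_of_le hTk.1.le]
      exact (outputComponent m n i p).continuous.comp_continuousOn (hx.continuousOn_Icc (hTm k))
    have hpi : ∀ i p, IntervalIntegrable
        (fun s => (x s).1 i p * (S.closedLoop s (x s)).1 i p) volume t₁ (T k) :=
      fun i p => (hgi i p).continuousOn_mul (hyc i p)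
    have henergy : ∀ i p, -(R ^ 2 / 2) ≤
        ∫ s in t₁..(T k), (x s).1 i p * (S.closedLoop s (x s)).1 i p := by
      intro i p
      rw [integral_primitive_mul (y := fun s => (x s).1 i p) hTk.1.le (hgi i p) fun t ht =>
        hx.apply_eq_add_integral (outputComponent m n i p)
          (mem_timeInterval_of_le (hTm k) ht.1 ht.2)]
      have hb : |(x t₁).1 i p| ≤ R := (norm_le_pi_norm _ p).trans
        (((norm_le_pi_norm _ i).trans (norm_fst_le _)).trans (hR t₁ ⟨le_rfl, htb⟩))
      have := sq_le_sq' (abs_le.1 hb).1 (abs_le.1 hb).2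
      nlinarith [sq_nonneg ((x (T k)).1 i p)]
    have hsi : IntervalIntegrable
        (fun s => ∑ p, ∑ i, (x s).1 i p * (S.closedLoop s (x s)).1 i p) volume t₁ (T k) := by
      have := IntervalIntegrable.sum (μ := volume) (a := t₁) (b := T k) Finset.univ
        (f := fun (p : Fin m) s => ∑ i, (x s).1 i p * (S.closedLoop s (x s)).1 i p) fun p _ => by
          have := IntervalIntegrable.sum (μ := volume) (a := t₁) (b := T k) Finset.univ
            (f := fun (i : Fin N) s => (x s).1 i p * (S.closedLoop s (x s)).1 i p)
            fun i _ => hpi i p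
          simpa only [Finset.sum_fn] using this
      simpa only [Finset.sum_fn] using this
    rw [← intervalIntegral.integral_of_le hTk.1.le]
    have h1 : ∫ s in t₁..(T k), ‖S.closedLoop s (x s)‖ ≤ ∫ s in t₁..(T k),
        (A - B * ∑ p, ∑ i, (x s).1 i p * (S.closedLoop s (x s)).1 i p) :=
      intervalIntegral.integral_mono_on hTk.1.le (hx.integrable _ (hTm k)).norm
        (intervalIntegrable_const.sub (hsi.const_mul B)) fun s hs =>
          hAB s ⟨hs.1, (hmem s hs).2.le⟩ _
            (hx.mem_domain s (mem_timeInterval_coe.2 (hmem s hs))) (hR s (hmem s hs))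
    refine h1.trans ?_
    rw [intervalIntegral.integral_sub intervalIntegrable_const (hsi.const_mul B),
      intervalIntegral.integral_const, intervalIntegral.integral_const_mul, smul_eq_mul]
    have h2 : -((m : ℝ) * (N * (R ^ 2 / 2))) ≤
        ∫ s in t₁..(T k), ∑ p, ∑ i, (x s).1 i p * (S.closedLoop s (x s)).1 i p := by
      rw [intervalIntegral.integral_finsetSum fun p _ => by
        have := IntervalIntegrable.sum (μ := volume) (a := t₁) (b := T k) Finset.univ
            (f := fun (i : Fin N) s => (x s).1 i p * (S.closedLoop s (x s)).1 i p)
            fun i _ => hpi i p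
        simpa only [Finset.sum_fn] using this]
      have h3 : -((m : ℝ) * (N * (R ^ 2 / 2))) = ∑ _p : Fin m, ∑ _i : Fin N, -(R ^ 2 / 2) := by
        simp
      rw [h3]
      refine Finset.sum_le_sum fun p _ => ?_
      rw [intervalIntegral.integral_finsetSum fun i _ => hpi i p]
      exact Finset.sum_le_sum fun i _ => henergy i p
    have h4 := mul_le_mul_of_nonneg_left h2 hB
    have h5 := mul_le_mul_of_nonneg_right (show T k - t₁ ≤ b - t₁ by linarith [hTk.2]) hA
    linarith

/-! ### The limit at a finite end time is unsaturated -/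

/-- The limit of a bounded closed loop solution at the end of a bounded interval lies inside the
funnel. -/
theorem limit_mem_funnel (hOpen : S.OpenLoopAssumption t₀)
    (hGain : S.GainAssumption t₀) (hDesign : S.DesignAssumption t₀) {t₁ b R : ℝ}
    (ht₁ : t₀ ≤ t₁) {x : ℝ → NetworkState m n} (hx : IsSolution S.funnel S.closedLoop t₁ b x)
    (hR : ∀ t ∈ Set.Ico t₁ b, ‖x t‖ ≤ R)
    (hi : IntervalIntegrable (fun s => S.closedLoop s (x s)) volume t₁ b) :
    (b, x t₁ + ∫ s in t₁..b, S.closedLoop s (x s)) ∈ S.funnel := by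
  have htb : t₁ < b := EReal.coe_lt_coe_iff.1 hx.lt
  have hb : t₀ ≤ b := ht₁.trans htb.le
  set L := x t₁ + ∫ s in t₁..b, S.closedLoop s (x s) with hL
  have hIco : ∀ᶠ t in 𝓝[<] b, t ∈ Set.Ico t₁ b := by
    filter_upwards [Ioo_mem_nhdsLT htb] with t ht using ⟨ht.1.le, ht.2⟩
  have hfun : ∀ t ∈ Set.Ico t₁ b, (t, x t) ∈ S.funnel := fun t ht =>
    hx.mem_domain t (mem_timeInterval_coe.2 ht)
  have hsub : ∀ t ∈ Set.Ico t₁ b, IntervalIntegrable (fun s => S.closedLoop s (x s)) volume t b := by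
    intro t ht
    refine hi.mono_set ?_
    rw [Set.uIcc_of_le ht.2.le, Set.uIcc_of_le htb.le]
    exact Set.Icc_subset_Icc_left ht.1
  have hxL : ∀ t ∈ Set.Ico t₁ b, x t = L - ∫ s in t..b, S.closedLoop s (x s) := by
    intro t ht
    have ht' := mem_timeInterval_coe.2 ht
    rw [hL, hx.eq_integral t ht', ← intervalIntegral.integral_add_adjacent_intervals
      (hx.integrable t ht') (hsub t ht)]
    abel
  have hlim : Tendsto x (𝓝[<] b) (𝓝 L) := by
    have h := intervalIntegral.continuousOn_primitive_interval' hi Set.left_mem_uIcc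
    rw [Set.uIcc_of_le htb.le] at h
    have h1 : Tendsto (fun t => ∫ s in t₁..t, S.closedLoop s (x s)) (𝓝[<] b)
        (𝓝 (∫ s in t₁..b, S.closedLoop s (x s))) :=
      (h b ⟨htb.le, le_rfl⟩).mono_left
        ((nhdsWithin_le_iff).2 (by filter_upwards [hIco] with t ht using ⟨ht.1, ht.2.le⟩))
    refine (tendsto_const_nhds.add h1).congr' ?_
    filter_upwards [hIco] with t ht
    exact (hx.eq_integral t (mem_timeInterval_coe.2 ht)).symm
  obtain ⟨K, hK0, hK⟩ := exists_open_loop_bound hOpen R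
  intro i₀ j₀ p hadj₀
  let g : Fin N → ℝ → ℝ := fun k t => (S.closedLoop t (x t)).1 k p
  have hg : ∀ k, ∀ t ∈ Set.Ico t₁ b,
      g k t = S.F k t ((x t).1 k) ((x t).2 k) p + ∑ j, S.edgeForce t (x t) p k j := fun k t ht =>
    closedLoop_fst_apply hGain (ht₁.trans ht.1) _ _ _
  have hF : ∀ k, ∀ t ∈ Set.Ico t₁ b, |S.F k t ((x t).1 k) ((x t).2 k) p| ≤ K := fun k t ht =>
    (norm_le_pi_norm _ p).trans (hK t (ht₁.trans ht.1) (x t) (hR t ht) k).1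
  have hylim : ∀ k, Tendsto (fun t => (x t).1 k p) (𝓝[<] b) (𝓝 (L.1 k p)) := fun k =>
    ((outputComponent m n k p).continuous.tendsto L).comp hlim
  have hψlim : ∀ {k j}, S.G.Adj k j → Tendsto (S.ψ k j p) (𝓝[<] b) (𝓝 (S.ψ k j p b)) :=
    fun {k j} h => ((continuousOn_psi hDesign h p) b hb).mono_left
      (nhdsWithin_le_iff.2 (by filter_upwards [hIco] with t ht using ht₁.trans ht.1))
  have hψb : ∀ {k j}, S.G.Adj k j → 0 < S.ψ k j p b := fun {k j} h =>
    hDesign.ψ_pos k j p h b hb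
  have hle : ∀ {k j}, S.G.Adj k j → |L.1 j p - L.1 k p| ≤ S.ψ k j p b := fun {k j} h =>
    le_of_tendsto_of_tendsto ((hylim j).sub (hylim k)).abs (hψlim h)
      (by filter_upwards [hIco] with t ht using (hfun t ht k j p h).le)
  -- Oriented saturation: `k` is the upper end of an edge that touches the funnel boundary in the
  -- limit.
  let sat : Fin N → Fin N → Prop := fun k j => S.G.Adj k j ∧ L.1 k p - L.1 j p = S.ψ k j p b
  have hratio : ∀ {k j}, S.G.Adj k j → Tendsto (fun t => ((x t).1 j p - (x t).1 k p) / S.ψ k j p t)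
      (𝓝[<] b) (𝓝 ((L.1 j p - L.1 k p) / S.ψ k j p b)) := fun {k j} h =>
    ((hylim j).sub (hylim k)).div (hψlim h) (hψb h).ne'
  have hmemIoo : ∀ {k j}, S.G.Adj k j → ∀ᶠ t in 𝓝[<] b,
      ((x t).1 j p - (x t).1 k p) / S.ψ k j p t ∈ Set.Ioo (-1 : ℝ) 1 := fun {k j} h => by
    filter_upwards [hIco] with t ht
    exact div_mem_Ioo_of_mem_funnel hDesign (ht₁.trans ht.1) (hfun t ht) h p
  -- The normalised difference has a limit in `(-1, 1]`: at `1` the force tends to `+∞`, otherwise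
  -- it converges.
  have hbelow : ∀ k j, ¬ sat k j → ∃ C, ∀ᶠ t in 𝓝[<] b, -C ≤ S.edgeForce t (x t) p k j := by
    intro k j hns
    by_cases h : S.G.Adj k j
    swap
    · exact ⟨0, Eventually.of_forall fun t => by simp [edgeForce_of_not_adj h]⟩
    simp only [edgeForce_of_adj h]
    have hle' := abs_le.1 (hle h)
    have hne : L.1 k p - L.1 j p ≠ S.ψ k j p b := fun he => hns ⟨h, he⟩
    have hgt : -1 < (L.1 j p - L.1 k p) / S.ψ k j p b := by
      rw [lt_div_iff₀ (hψb h)]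
      have := lt_of_le_of_ne (show L.1 k p - L.1 j p ≤ S.ψ k j p b by linarith) hne
      linarith
    have hle1 : (L.1 j p - L.1 k p) / S.ψ k j p b ≤ 1 := by
      rw [div_le_iff₀ (hψb h)]; linarith
    rcases eq_or_lt_of_le hle1 with h1 | h1
    · refine ⟨0, ?_⟩
      have ht : Tendsto (fun t => ((x t).1 j p - (x t).1 k p) / S.ψ k j p t) (𝓝[<] b) (𝓝[<] 1) :=
        tendsto_nhdsWithin_iff.2 ⟨h1 ▸ hratio h, (hmemIoo h).mono fun t ht => ht.2⟩
      simpa using ((hDesign.μ_tendsto_right k j p h).comp ht).eventually_ge_atTop 0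
    · have hc := ((hDesign.μ_continuousOn k j p h).continuousAt (Ioo_mem_nhds hgt h1)).tendsto.comp
        (hratio h)
      refine ⟨-(S.μ k j p ((L.1 j p - L.1 k p) / S.ψ k j p b) - 1), ?_⟩
      filter_upwards [hc.eventually (lt_mem_nhds (sub_one_lt _))] with t ht
      simpa using ht.le
  have habove : ∀ k j, ¬ sat j k → ∃ C, ∀ᶠ t in 𝓝[<] b, S.edgeForce t (x t) p k j ≤ C := by
    intro k j hns
    obtain ⟨C, hC⟩ := hbelow j k hns
    refine ⟨C, ?_⟩
    filter_upwards [hC, hIco] with t h1 h2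
    rw [edgeForce_antisymm hDesign (ht₁.trans h2.1) (hfun t h2)]
    linarith
  have hnot : ∀ k j, ¬ sat k j := by
    refine not_saturated (y := fun k t => (x t).1 k p) (g := g) (l := fun k => L.1 k p) htb
      (fun k => ⟨(outputComponent m n k p).integrable_comp hi.1,
        (outputComponent m n k p).integrable_comp hi.2⟩) (fun k t ht => ?_) ?_ ?_ ?_ ?_
    · have := congrArg (outputComponent m n k p) (hxL t ht)
      rwa [map_sub, ← (outputComponent m n k p).intervalIntegral_comp_comm (hsub t ht)] at this
    · rintro k j ⟨h, heq⟩
      linarith [hψb h]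
    · intro k hk
      choose C hC using fun j => hbelow k j (hk j)
      refine ⟨K + ∑ j, C j, ?_⟩
      filter_upwards [eventually_all.2 hC, hIco] with t h1 h2
      rw [hg k t h2]
      have h3 : -∑ j, C j ≤ ∑ j, S.edgeForce t (x t) p k j := by
        rw [← Finset.sum_neg_distrib]
        exact Finset.sum_le_sum fun j _ => h1 j
      linarith [(abs_le.1 (hF k t h2)).1]
    · rintro k j ⟨h, heq⟩
      obtain ⟨D, hD⟩ := exists_abs_psi_sub_le hDesign h p
      refine ⟨D, ?_⟩
      filter_upwards [hIco] with t ht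
      have h1 := (abs_lt.1 (hfun t ht k j p h)).1
      have h2 := hD b t hb (ht₁.trans ht.1)
      rw [abs_sub_comm t b, abs_of_pos (sub_pos.2 ht.2)] at h2
      have h3 := (abs_le.1 h2).2
      simp only at h1
      linarith
    · rintro k j ⟨h, heq⟩ hup
      choose C hC using fun i => habove k i (hup i)
      -- The saturated lower neighbour pulls with force tending to `-∞`. All other forces are
      -- bounded above because no upper neighbour is saturated.
      have hbot : Tendsto (fun t => S.edgeForce t (x t) p k j) (𝓝[<] b) atBot := by
        simp only [edgeForce_of_adj h]
        refine (hDesign.μ_tendsto_left k j p h).comp (tendsto_nhdsWithin_iff.2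
          ⟨?_, (hmemIoo h).mono fun t ht => ht.1⟩)
        have h1 : (L.1 j p - L.1 k p) / S.ψ k j p b = -1 := by
          rw [div_eq_iff (hψb h).ne']; linarith
        exact h1 ▸ hratio h
      refine tendsto_atBot_mono' _ ?_
        (tendsto_atBot_add_const_right _ (K + ∑ i ∈ Finset.univ.erase j, C i) hbot)
      filter_upwards [eventually_all.2 hC, hIco] with t h1 h2
      rw [hg k t h2, ← Finset.add_sum_erase _ _ (Finset.mem_univ j)]
      have h3 : ∑ i ∈ Finset.univ.erase j, S.edgeForce t (x t) p k i ≤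
          ∑ i ∈ Finset.univ.erase j, C i := Finset.sum_le_sum fun i _ => h1 i
      linarith [(abs_le.1 (hF k t h2)).2]
  refine lt_of_le_of_ne (hle hadj₀) fun heq => ?_
  rcases abs_cases (L.1 j₀ p - L.1 i₀ p) with ⟨h1, -⟩ | ⟨h1, -⟩
  · refine hnot j₀ i₀ ⟨hadj₀.symm, ?_⟩
    rw [← hDesign.ψ_symm i₀ j₀ p hadj₀ b hb, ← heq]
    exact h1.symm
  · refine hnot i₀ j₀ ⟨hadj₀, ?_⟩
    have h2 : |L.1 j₀ p - L.1 i₀ p| = S.ψ i₀ j₀ p b := heq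
    linarith

/-! ### Local existence inside the funnel -/

theorem closedLoop_eq (hGain : S.GainAssumption t₀) {t : ℝ} (ht : t₀ ≤ t) (x : NetworkState m n) :
    S.closedLoop t x = (fun i p => S.F i t (x.1 i) (x.2 i) p + ∑ j, S.edgeForce t x p i j,
      fun i => S.Z i t (x.2 i) (x.1 i)) :=
  Prod.ext (funext fun i => funext fun p => closedLoop_fst_apply hGain ht x i p) rfl

theorem continuousOn_ratio (hDesign : S.DesignAssumption t₀) {i j : Fin N} (h : S.G.Adj i j)
    (p : Fin m) : ContinuousOn
      (fun a : ℝ × NetworkState m n => (a.2.1 j p - a.2.1 i p) / S.ψ i j p a.1)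
      (Prod.fst ⁻¹' Set.Ici t₀) := by
  refine ContinuousOn.div (by fun_prop)
    ((continuousOn_psi hDesign h p).comp continuousOn_fst fun a ha => ha) fun a ha => ?_
  exact (hDesign.ψ_pos i j p h a.1 ha).ne'

theorem continuousOn_edgeForce (hDesign : S.DesignAssumption t₀) (i j : Fin N) (p : Fin m) :
    ContinuousOn (fun a : ℝ × NetworkState m n => S.edgeForce a.1 a.2 p i j)
      (S.funnel ∩ Prod.fst ⁻¹' Set.Ici t₀) := by
  by_cases h : S.G.Adj i j
  · simp only [edgeForce_of_adj h]
    exact (hDesign.μ_continuousOn i j p h).comp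
      ((continuousOn_ratio hDesign h p).mono Set.inter_subset_right)
      fun a ha => div_mem_Ioo_of_mem_funnel hDesign ha.2 ha.1 h p
  · simp only [edgeForce_of_not_adj h]
    exact continuousOn_const

/-- Inside the funnel the coupling is defined on a cylinder. -/
theorem exists_cylinder_subset_funnel (hDesign : S.DesignAssumption t₀) {b : ℝ} (hb : t₀ ≤ b)
    {x₀ : NetworkState m n} (hx₀ : (b, x₀) ∈ S.funnel) :
    ∃ r, 0 < r ∧ Set.Icc b (b + r) ×ˢ Metric.closedBall x₀ r ⊆ S.funnel := by
  have hev : ∀ᶠ a in 𝓝[Prod.fst ⁻¹' Set.Ici t₀] (b, x₀), a ∈ S.funnel := by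
    simp only [funnel, Set.mem_ofPred_eq]
    refine eventually_all.2 fun i => eventually_all.2 fun j => eventually_all.2 fun p =>
      eventually_imp_distrib_left.2 fun h => ?_
    have h1 : ContinuousWithinAt (fun a : ℝ × NetworkState m n => |a.2.1 j p - a.2.1 i p|)
        (Prod.fst ⁻¹' Set.Ici t₀) (b, x₀) := by fun_prop
    have h2 : ContinuousWithinAt (fun a : ℝ × NetworkState m n => S.ψ i j p a.1)
        (Prod.fst ⁻¹' Set.Ici t₀) (b, x₀) :=
      (((continuousOn_psi hDesign h p).comp continuousOn_fst fun a ha => ha) (b, x₀) hb)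
    exact h1.eventually_lt h2 (hx₀ i j p h)
  obtain ⟨δ, hδ, hsub⟩ := Metric.mem_nhdsWithin_iff.1 hev
  refine ⟨δ / 2, half_pos hδ, fun a ha => hsub ⟨?_, hb.trans ha.1.1⟩⟩
  rw [Metric.mem_ball, Prod.dist_eq, max_lt_iff]
  refine ⟨?_, (Metric.mem_closedBall.1 ha.2).trans_lt (half_lt_self hδ)⟩
  rw [Real.dist_eq, abs_of_nonneg (sub_nonneg.2 ha.1.1)]
  linarith [ha.1.2]

/-- The closed loop has local solutions inside the funnel. -/
theorem exists_local_solution (hOpen : S.OpenLoopAssumption t₀) (hGain : S.GainAssumption t₀)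
    (hDesign : S.DesignAssumption t₀) {b : ℝ} (hb : t₀ ≤ b) {x₀ : NetworkState m n}
    (hx₀ : (b, x₀) ∈ S.funnel) :
    ∃ c, b < c ∧ ∃ ξ : ℝ → NetworkState m n, (∀ t ∈ Set.Icc b c, (t, ξ t) ∈ S.funnel) ∧
      IntervalIntegrable (fun s => S.closedLoop s (ξ s)) volume b c ∧
      ∀ t ∈ Set.Icc b c, ξ t = x₀ + ∫ s in b..t, S.closedLoop s (ξ s) := by
  obtain ⟨r, hr, hsub⟩ := exists_cylinder_subset_funnel hDesign hb hx₀
  have hsub' : Set.Icc b (b + r) ×ˢ Metric.closedBall x₀ r ⊆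
      S.funnel ∩ Prod.fst ⁻¹' Set.Ici t₀ := fun a ha => ⟨hsub ha, hb.trans ha.1.1⟩
  have hcpt : IsCompact (Set.Icc b (b + r) ×ˢ Metric.closedBall x₀ r) :=
    isCompact_Icc.prod (isCompact_closedBall _ _)
  have hEc : ∀ i j p, ContinuousOn (fun a : ℝ × NetworkState m n => S.edgeForce a.1 a.2 p i j)
      (Set.Icc b (b + r) ×ˢ Metric.closedBall x₀ r) := fun i j p =>
    (continuousOn_edgeForce hDesign i j p).mono hsub'
  obtain ⟨K, hK0, hK⟩ := exists_open_loop_bound hOpen (‖x₀‖ + r)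
  choose E hE using fun a : Fin N × Fin N × Fin m =>
    (hcpt.image_of_continuousOn (hEc a.1 a.2.1 a.2.2)).isBounded.exists_norm_le
  have hnorm : ∀ x ∈ Metric.closedBall x₀ r, ‖x‖ ≤ ‖x₀‖ + r := fun x hx => by
    have := norm_le_norm_add_norm_sub' x x₀
    rw [Metric.mem_closedBall, dist_eq_norm] at hx
    linarith
  set B := K + ∑ i, ∑ j, ∑ p, |E (i, j, p)| with hBdef
  have hB0 : 0 ≤ B := by positivity
  have hB : ∀ t ∈ Set.Icc b (b + r), ∀ x ∈ Metric.closedBall x₀ r, ‖S.closedLoop t x‖ ≤ B := by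
    intro t ht x hx
    have hKx := hK t (hb.trans ht.1) x (hnorm x hx)
    rw [closedLoop_eq hGain (hb.trans ht.1)]
    refine max_le ((pi_norm_le_iff_of_nonneg hB0).2 fun i =>
      (pi_norm_le_iff_of_nonneg hB0).2 fun p => ?_) ((pi_norm_le_iff_of_nonneg hB0).2 fun i => ?_)
    · refine (norm_add_le _ _).trans (add_le_add ((norm_le_pi_norm _ p).trans (hKx i).1) ?_)
      have h1 : ∀ j, ‖S.edgeForce t x p i j‖ ≤ ∑ p, |E (i, j, p)| := fun j =>
        ((hE (i, j, p) _ ⟨(t, x), ⟨ht, hx⟩, rfl⟩).trans (le_abs_self _)).trans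
          (Finset.single_le_sum (f := fun p => |E (i, j, p)|) (fun p _ => abs_nonneg _)
            (Finset.mem_univ p))
      refine (norm_sum_le _ _).trans ((Finset.sum_le_sum fun j _ => h1 j).trans ?_)
      exact Finset.single_le_sum (f := fun i => ∑ j, ∑ p, |E (i, j, p)|)
        (fun i _ => by positivity) (Finset.mem_univ i)
    · exact (hKx i).2.trans (le_add_of_nonneg_right (by positivity))
  -- This makes `B * h ≤ r`; the `+ 1` keeps the denominator positive when `B = 0`.
  set h := min r (r / (B + 1)) with hh
  have hpos : 0 < h := lt_min hr (by positivity)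
  have hIcc : Set.Icc b (b + h) ⊆ Set.Icc b (b + r) :=
    Set.Icc_subset_Icc_right (by linarith [min_le_left r (r / (B + 1))])
  have hBr : B * (b + h - b) ≤ r := by
    have h1 : h ≤ r / (B + 1) := min_le_right _ _
    rw [le_div_iff₀ (by positivity)] at h1
    nlinarith
  have hmeas : ∀ x ∈ Metric.closedBall x₀ r, AEStronglyMeasurable (fun t => S.closedLoop t x)
      (volume.restrict (Set.Icc b (b + h))) := by
    intro x hx
    have hres : ∀ {E : Type} [TopologicalSpace E] {u : ℝ → E},
        AEStronglyMeasurable u (volume.restrict (Set.Ici t₀)) →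
        AEStronglyMeasurable u (volume.restrict (Set.Icc b (b + h))) := fun hu =>
      hu.mono_measure (Measure.restrict_mono (fun t ht => hb.trans ht.1) le_rfl)
    refine AEStronglyMeasurable.congr (f := fun t =>
      ((fun i p => S.F i t (x.1 i) (x.2 i) p + ∑ j, S.edgeForce t x p i j,
        fun i => S.Z i t (x.2 i) (x.1 i)) : NetworkState m n)) ?_ ?_
    · refine AEStronglyMeasurable.prodMk ?_ ?_
      · refine (aemeasurable_pi_lambda _ fun i => aemeasurable_pi_lambda _ fun p =>
          AEMeasurable.add ?_ ?_).aestronglyMeasurable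
        · exact (measurable_pi_apply p).comp_aemeasurable
            (hres ((hOpen.F_regular i).measurable (x.1 i, x.2 i))).aemeasurable
        · refine Finset.aemeasurable_fun_sum _ fun j _ => ?_
          refine ContinuousOn.aemeasurable ?_ measurableSet_Icc
          exact (hEc i j p).comp (f := fun t => (t, x)) (by fun_prop) fun t ht => ⟨hIcc ht, hx⟩
      · exact (aemeasurable_pi_lambda _ fun i =>
          (hres ((hOpen.Z_regular i).measurable (x.1 i, x.2 i))).aemeasurable).aestronglyMeasurable
    · refine (ae_restrict_iff' measurableSet_Icc).2 (ae_of_all _ fun t ht => ?_)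
      exact (closedLoop_eq hGain (hb.trans ht.1) x).symm
  have hcont : ∀ t ∈ Set.Icc b (b + h),
      ContinuousOn (S.closedLoop t) (Metric.closedBall x₀ r) := by
    intro t ht
    have ht' : t₀ ≤ t := hb.trans ht.1
    have hmaps : ∀ i, Set.MapsTo (fun x : NetworkState m n => (x.1 i, x.2 i))
        (Metric.closedBall x₀ r) (Metric.closedBall (x₀.1 i, x₀.2 i) r) := by
      intro i x hx
      rw [Metric.mem_closedBall] at hx ⊢
      exact (max_le_max (dist_le_pi_dist _ _ i) (dist_le_pi_dist _ _ i)).trans hx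
    have hpair : ∀ i, ContinuousOn (fun x : NetworkState m n => (x.1 i, x.2 i))
        (Metric.closedBall x₀ r) := fun i => by fun_prop
    refine ContinuousOn.congr (f := fun x : NetworkState m n =>
      ((fun i p => S.F i t (x.1 i) (x.2 i) p + ∑ j, S.edgeForce t x p i j,
        fun i => S.Z i t (x.2 i) (x.1 i)) : NetworkState m n)) ?_
        fun x _ => closedLoop_eq hGain ht' x
    refine ContinuousOn.prodMk (continuousOn_pi.2 fun i => continuousOn_pi.2 fun p =>
      ContinuousOn.add ?_ (continuousOn_finsetSum _ fun j _ => ?_)) (continuousOn_pi.2 fun i => ?_)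
    · obtain ⟨L, hL⟩ := (hOpen.F_regular i).lipschitz _
        (isCompact_closedBall (x₀.1 i, x₀.2 i) r) t
      exact (continuous_apply p).comp_continuousOn
        ((hL t ⟨ht', le_rfl⟩).continuousOn.comp (hpair i) (hmaps i))
    · exact (hEc i j p).comp (f := fun x => (t, x)) (by fun_prop) fun x hx => ⟨hIcc ht, hx⟩
    · obtain ⟨L, hL⟩ := (hOpen.Z_regular i).lipschitz _
        (isCompact_closedBall (x₀.1 i, x₀.2 i) r) t
      exact (hL t ⟨ht', le_rfl⟩).continuousOn.comp (hpair i) (hmaps i)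
  obtain ⟨ξ, hξ, hξi, hξe⟩ := exists_solution_of_closedBall (by linarith) hr hBr hmeas hcont
    fun t ht x hx => hB t (hIcc ht) x hx
  exact ⟨b + h, by linarith, ξ, fun t ht => hsub ⟨hIcc ht, hξ t ht⟩, hξi, hξe⟩

/-! ### Global existence -/

/-- Maximal solutions of the closed loop are global. -/
theorem eq_top_of_isMaximalSolution (hOpen : S.OpenLoopAssumption t₀)
    (hGain : S.GainAssumption t₀) (hGraph : S.G.Connected) (hDesign : S.DesignAssumption t₀)
    (hglobal : ∀ t₁, t₀ ≤ t₁ → ∀ (ξ : BlendedState m n) (e : ℝ → Fin N → Fin m → ℝ),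
      IsLocEssBounded t₁ e →
      ∃ x : ℝ → BlendedState m n, x t₁ = ξ ∧
        IsSolution Set.univ (fun t ξ => S.blended t ξ (e t)) t₁ ⊤ x)
    {t₁ : ℝ} (ht₁ : t₀ ≤ t₁) {ω : EReal} {x : ℝ → NetworkState m n}
    (hx : IsMaximalSolution S.funnel S.closedLoop t₁ ω x) : ω = ⊤ := by
  induction ω with
  | bot => exact absurd hx.isSolution.lt not_lt_bot
  | top => rfl
  | coe b =>
    exfalso
    obtain ⟨R, hR⟩ := exists_norm_le_of_isSolution hOpen hGain hGraph hDesign hglobal ht₁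
      hx.isSolution
    have hi := intervalIntegrable_closedLoop hOpen hGain hDesign ht₁ hx.isSolution hR
    have hmem := limit_mem_funnel hOpen hGain hDesign ht₁ hx.isSolution hR hi
    have htb : t₁ < b := EReal.coe_lt_coe_iff.1 hx.isSolution.lt
    obtain ⟨c, hbc, ξ, hξm, hξi, hξ⟩ :=
      exists_local_solution hOpen hGain hDesign (ht₁.trans htb.le) hmem
    obtain ⟨x₂, hx₂, heq⟩ := hx.isSolution.exists_concat hi hbc hξm hξi hξ
    exact (EReal.coe_le_coe_iff.1 (hx.maximal c x₂ hx₂ heq)).not_gt hbc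

end MultiAgentSystem

/-! ### The estimate with fading memory -/

theorem IsClassK.nonneg {α : ℝ → ℝ} (h : IsClassK α) {r : ℝ} (hr : 0 ≤ r) : 0 ≤ α r :=
  h.map_zero ▸ h.strictMonoOn.monotoneOn Set.self_mem_Ici hr hr

theorem IsClassK.mono {α : ℝ → ℝ} (h : IsClassK α) {r s : ℝ} (hr : 0 ≤ r) (hrs : r ≤ s) :
    α r ≤ α s :=
  h.strictMonoOn.monotoneOn hr (hr.trans hrs) hrs

/-- Class `K∞` gain for a fading memory weight `w`: it dominates the trade-off between forgetting
the state before the last `T` units of time and the input during these. -/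
theorem exists_fading_memory_gain {β : ℝ → ℝ → ℝ} {γhat w : ℝ → ℝ} (hβ : IsClassKL β)
    (hγ : IsClassKInfty γhat) (hw : ∀ t, 0 ≤ t → w t ∈ Set.Ioc (0 : ℝ) 1) {R : ℝ} (hR : 0 ≤ R) :
    ∃ γ, IsClassKInfty γ ∧ ∀ D, 0 ≤ D → ∀ v : ℝ,
      (∀ T, 0 ≤ T → v ≤ β R T + γhat (D / w T)) → v ≤ γ D := by
  -- The best trade-off over all memory lengths `T`. For small `D`, choosing first `T` with `β R T`
  -- small and then `D = δ * w T` makes it small.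
  let g : ℝ → ℝ := fun D => ⨅ T : Set.Ici (0 : ℝ), (β R T + γhat (D / w T))
  have hterm : ∀ D, 0 ≤ D → ∀ T : Set.Ici (0 : ℝ), 0 ≤ β R T + γhat (D / w T) := fun D hD T =>
    add_nonneg ((hβ.isClassK T T.2).nonneg hR)
      (hγ.toIsClassK.nonneg (div_nonneg hD (hw T T.2).1.le))
  have hbdd : ∀ D, 0 ≤ D →
      BddBelow (Set.range fun T : Set.Ici (0 : ℝ) => β R T + γhat (D / w T)) := fun D hD =>
    ⟨0, by rintro _ ⟨T, rfl⟩; exact hterm D hD T⟩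
  obtain ⟨γ, hγK, hle⟩ := exists_isClassKInfty_ge (g := g)
    (fun D hD D' _ h => ciInf_mono (hbdd D hD) fun T => by
      have hT := (hw T T.2).1
      have := hγ.toIsClassK.mono (div_nonneg hD hT.le) (div_le_div_of_nonneg_right h hT.le)
      linarith)
    (fun D hD => Real.iInf_nonneg (hterm D hD))
    (fun ε hε => by
      obtain ⟨T, hT, hT0⟩ := (((hβ.tendsto_zero R hR).eventually
        (gt_mem_nhds (half_pos hε))).and (eventually_ge_atTop 0)).exists
      have hc : Tendsto γhat (𝓝[>] 0) (𝓝 0) := by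
        have := hγ.continuousOn 0 Set.self_mem_Ici
        rw [ContinuousWithinAt, hγ.map_zero] at this
        exact this.mono_left (nhdsWithin_mono _ Set.Ioi_subset_Ici_self)
      obtain ⟨δ, hδ, hδ0⟩ := ((hc.eventually (gt_mem_nhds (half_pos hε))).and
        self_mem_nhdsWithin).exists
      have hδ0 : 0 < δ := hδ0
      have hwT := (hw T hT0).1
      refine ⟨δ * w T, by positivity, ?_⟩
      refine (ciInf_le (hbdd _ (by positivity)) ⟨T, hT0⟩).trans_lt ?_
      simp only [mul_div_cancel_right₀ _ hwT.ne']
      linarith)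
  exact ⟨γ, hγK, fun D hD v hv => (le_ciInf fun T : Set.Ici (0 : ℝ) => hv T T.2).trans (hle D hD)⟩

namespace MultiAgentSystem

variable {N m : ℕ} {n q : Fin N → ℕ} {S : MultiAgentSystem N m n q} {t₀ : ℝ}

/-- The ISS estimate along the mean of a global closed loop solution. -/
theorem infDist_average_le {A : Set (BlendedState m n)} {β : ℝ → ℝ → ℝ} {γhat : ℝ → ℝ}
    (hISS : IsISS t₀ S.blended β γhat A) (hGain : S.GainAssumption t₀) (hGraph : S.G.Connected)
    (hDesign : S.DesignAssumption t₀) {t₁ : ℝ} (ht₁ : t₀ ≤ t₁) {x : ℝ → NetworkState m n}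
    (hx : IsSolution S.funnel S.closedLoop t₁ ⊤ x) {t Q : ℝ} (ht : t₁ ≤ t) (hQ0 : 0 ≤ Q)
    (hQ : ∀ s ∈ Set.Ico t₁ t, S.syncBound s ≤ Q) :
    Metric.infDist (average m n (x t)) A ≤
      β (Metric.infDist (average m n (x t₁)) A) (t - t₁) + γhat Q := by
  obtain ⟨P, -, hP⟩ := exists_syncBound_le hDesign
  have hdev : ∀ s, t₁ ≤ s → ‖deviation (x s)‖ ≤ S.syncBound s := fun s hs =>
    norm_deviation_le' hGraph hDesign (ht₁.trans hs) (hx.mem_domain s (mem_timeInterval_top.2 hs))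
  have hbdd : IsLocEssBounded t₁ fun s => deviation (x s) := by
    intro T
    refine memLp_top_of_bound ?_ P
      ((ae_restrict_iff' measurableSet_Icc).2 (ae_of_all _ fun s hs =>
        (hdev s hs.1).trans (hP s (ht₁.trans hs.1))))
    rcases lt_or_ge T t₁ with h | h
    · simp [Set.Icc_eq_empty_of_lt h]
    · exact (continuous_deviation.comp_continuousOn
        (hx.continuousOn_Icc (mem_timeInterval_top.2 h))).aestronglyMeasurable measurableSet_Icc
  refine (hISS.estimate t₁ ht₁ _ _ hbdd
    (isSolution_average hGain hDesign ht₁ hx fun _ _ => rfl) t ht).trans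
    (add_le_add_right (hISS.isClassKInfty.toIsClassK.mono ENNReal.toReal_nonneg ?_) _)
  refine ENNReal.toReal_le_of_le_ofReal hQ0 ?_
  rw [eLpNorm_exponent_top]
  exact eLpNormEssSup_le_of_ae_bound ((ae_restrict_iff' measurableSet_Ico).2
    (ae_of_all _ fun s hs => (hdev s hs.1).trans (hQ s hs)))

end MultiAgentSystem

end FunnelCoupling

/-! ### The estimate along closed loop solutions -/

open FunnelCoupling in
theorem theorem3 {N m : ℕ} {n q : Fin N → ℕ} (S : MultiAgentSystem N m n q) (t₀ : ℝ)
    (hOpen : S.OpenLoopAssumption t₀)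
    (hGain : S.GainAssumption t₀)
    (hGraph : S.G.Connected)
    (hDesign : S.DesignAssumption t₀)
    (hEscape : S.NoFiniteEscape t₀)
    (A : Set (BlendedState m n)) (hA : IsClosed A) (hA' : A.Nonempty)
    (β : ℝ → ℝ → ℝ) (γhat : ℝ → ℝ)
    (hISS : IsISS t₀ S.blended β γhat A)
    (M : ℝ) (hM : 0 < M)
    (w : ℝ → ℝ) (hw_mem : ∀ t, 0 ≤ t → w t ∈ Set.Ioc (0 : ℝ) 1)
    (hw_anti : AntitoneOn w (Set.Ici 0))
    (hw_lim : Filter.Tendsto w Filter.atTop (nhds 0)) :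
    ∃ γ : ℝ → ℝ, IsClassKInfty γ ∧
      ∀ (t₁ : ℝ), t₀ ≤ t₁ → ∀ (ω : EReal) (x : ℝ → NetworkState m n),
        IsMaximalSolution S.funnel S.closedLoop t₁ ω x →
        Metric.infDist
          (((1 / (N : ℝ)) • ∑ i, (x t₁).1 i, (x t₁).2) : BlendedState m n) A ≤ M →
        ω = ⊤ ∧
        ∀ t, t₁ ≤ t → ∀ i : Fin N,
          Metric.infDist (((x t).1 i, (x t).2) : BlendedState m n) A ≤
            β (Metric.infDist
                (((1 / (N : ℝ)) • ∑ j, (x t₁).1 j, (x t₁).2) : BlendedState m n) A) (t - t₁)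
              + γ (⨆ s : Set.Ico t₁ t, S.syncBound s * w (t - s))
              + S.syncBound t := by
  have hβ := hISS.isClassKL
  have hγ := hISS.isClassKInfty.toIsClassK
  obtain ⟨P, hP0, hP⟩ := MultiAgentSystem.exists_syncBound_le hDesign
  -- A bound for the mean state at every time, obtained from the ISS estimate with input at most
  -- `P`. It is independent of `t₁` and of the solution, and hence so is the gain.
  have hR : 0 ≤ β M 0 + γhat P := add_nonneg ((hβ.isClassK 0 le_rfl).nonneg hM.le) (hγ.nonneg hP0)
  obtain ⟨γ, hγK, hgain⟩ := exists_fading_memory_gain hβ hISS.isClassKInfty hw_mem hR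
  refine ⟨γ, hγK, fun t₁ ht₁ ω x hx hM₁ => ?_⟩
  have hω := MultiAgentSystem.eq_top_of_isMaximalSolution hOpen hGain hGraph hDesign
    hISS.exists_global ht₁ hx
  refine ⟨hω, fun t ht i => ?_⟩
  subst hω
  have hsol := hx.isSolution
  simp only [← MultiAgentSystem.average_apply] at hM₁ ⊢
  have hr0 : 0 ≤ Metric.infDist (MultiAgentSystem.average m n (x t₁)) A := Metric.infDist_nonneg
  have hβ0 : ∀ s, t₁ ≤ s →
      0 ≤ β (Metric.infDist (MultiAgentSystem.average m n (x t₁)) A) (s - t₁) := fun s hs =>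
    (hβ.isClassK _ (sub_nonneg.2 hs)).nonneg hr0
  -- For `t = t₁` the index set is empty and the real supremum is `0` by default, as the convention
  -- demands.
  set D := ⨆ s : Set.Ico t₁ t, S.syncBound s * w (t - s) with hD
  have hprod : ∀ s : Set.Ico t₁ t, 0 ≤ S.syncBound s * w (t - s) ∧
      S.syncBound s * w (t - s) ≤ P := by
    intro s
    have hw := hw_mem (t - s) (sub_nonneg.2 s.2.2.le)
    have h0 := MultiAgentSystem.syncBound_nonneg hDesign (ht₁.trans s.2.1)
    exact ⟨mul_nonneg h0 hw.1.le,
      (mul_le_of_le_one_right h0 hw.2).trans (hP s (ht₁.trans s.2.1))⟩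
  have hD0 : 0 ≤ D := Real.iSup_nonneg fun s => (hprod s).1
  -- An input of age at most `T` has weight at least `w T`, since `w` is non-increasing.
  have hrecent : ∀ T, 0 ≤ T → ∀ s ∈ Set.Ico t₁ t, t - s ≤ T → S.syncBound s ≤ D / w T := by
    intro T hT s hs hsT
    rw [le_div_iff₀ (hw_mem T hT).1]
    refine (mul_le_mul_of_nonneg_left (hw_anti (Set.mem_Ici.2 (sub_nonneg.2 hs.2.le)) hT hsT)
      (MultiAgentSystem.syncBound_nonneg hDesign (ht₁.trans hs.1))).trans ?_
    exact le_ciSup (f := fun s : Set.Ico t₁ t => S.syncBound s * w (t - s))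
      ⟨P, by rintro _ ⟨s, rfl⟩; exact (hprod s).2⟩ ⟨s, hs⟩
  have hmean : Metric.infDist (MultiAgentSystem.average m n (x t)) A ≤
      β (Metric.infDist (MultiAgentSystem.average m n (x t₁)) A) (t - t₁) + γ D := by
    rw [← sub_le_iff_le_add']
    refine hgain D hD0 _ fun T hT => ?_
    have hDT : 0 ≤ D / w T := div_nonneg hD0 (hw_mem T hT).1.le
    -- If `t - T` is not before `t₁`, restart there from a state within radius `β M 0 + γhat P`.
    -- Otherwise all inputs are recent and one ISS estimate from `t₁` suffices.
    rcases le_or_gt t₁ (t - T) with h | h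
    · have h1 := MultiAgentSystem.infDist_average_le hISS hGain hGraph hDesign ht₁ hsol h hP0
        fun s hs => hP s (ht₁.trans hs.1)
      have h2 : β (Metric.infDist (MultiAgentSystem.average m n (x t₁)) A) (t - T - t₁) ≤
          β M 0 :=
        (hβ.antitoneOn _ hr0 Set.self_mem_Ici (Set.mem_Ici.2 (by linarith)) (by linarith)).trans
          ((hβ.isClassK 0 le_rfl).mono hr0 hM₁)
      have h3 := MultiAgentSystem.infDist_average_le hISS hGain hGraph hDesign (ht₁.trans h)
        (hsol.restart h) (t := t) (by linarith) hDT
        fun s hs => hrecent T hT s ⟨h.trans hs.1, hs.2⟩ (by linarith [hs.1])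
      rw [sub_sub_cancel] at h3
      have h4 := (hβ.isClassK T hT).mono Metric.infDist_nonneg (h1.trans (add_le_add_left h2 _))
      linarith [hβ0 t ht]
    · have h1 := MultiAgentSystem.infDist_average_le hISS hGain hGraph hDesign ht₁ hsol ht hDT
        fun s hs => hrecent T hT s hs (by linarith [hs.1])
      linarith [(hβ.isClassK T hT).nonneg hR]
  have hdist : dist (((x t).1 i, (x t).2) : BlendedState m n)
      (MultiAgentSystem.average m n (x t)) ≤ S.syncBound t := by
    have ht' := ht₁.trans ht
    rw [Prod.dist_eq]
    refine max_le ?_ ?_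
    · rw [dist_eq_norm]
      exact MultiAgentSystem.norm_deviation_le hGraph hDesign ht'
        (hsol.mem_domain t (mem_timeInterval_top.2 ht)) i
    · rw [MultiAgentSystem.average_apply, dist_self]
      exact MultiAgentSystem.syncBound_nonneg hDesign ht'
  -- The distance to `A` is 1-Lipschitz, so replacing the mean by one output costs at most the
  -- synchronization bound.
  linarith [Metric.infDist_le_infDist_add_dist (s := A)
    (x := (((x t).1 i, (x t).2) : BlendedState m n)) (y := MultiAgentSystem.average m n (x t))]
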